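/- Let $X$ be a complex Banach space, $-1<\gamma<0$, $0<\omega<\pi/2$, and let $A:D(A)\subset X\to X$ be an almost sectorial operator of class $\Theta^\gamma_\omega(X)$: $A$ is closed and linear, $\sigma(A)\subset S_\omega$, where $S_\mu=\{z\neq0:|\arg z|\le\mu\}\cup\{0\}$, and for every $\mu\in(\omega,\pi)$ there is $C_\mu>0$ with $\|(z-A)^{-1}\|\le C_\mu|z|^\gamma$ for $z\notin S_\mu$. Let $0<\alpha<\frac{\pi}{2\omega}$, $\omega<\theta<\min\{\pi,\frac{\pi}{2\alpha}\}$, and $T>0$. Let $A^\alpha$ be the fractional power of $A$ given by the regularized functional calculus, i.e. $A^\alpha x=y$ means $\frac1{2\pi i}\int_{\Gamma_\theta}\frac{z^\alpha}{(1+z)^{m}}(z-A)^{-1}x\,dz=(1+A)^{-m}y$ with $m=\lfloor\alpha\rfloor+2$, and put $$\mathscr T_\alpha(t)=\frac1{2\pi i}\int_{\Gamma_\theta}e^{-tz^\alpha}(z-A)^{-1}\,dz\qquad(t>0),$$ where $\Gamma_\theta=\{\rho e^{-i\theta}:\rho>0\}\cup\{\rho e^{i\theta}:\rho>0\}$ is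 oriented so that the sector $|\arg z|<\theta$ lies to its left. A *coefficient* is a continuous function $\varphi:[0,\infty)\to[0,\infty)$ with $\varphi(t)>0$ for $t>0$. For a sign $\sigma\in\{1,-1\}$, a coefficient $\varphi$ and $x_0\in X$, a *classical solution* of $$u_t(t)=\sigma\varphi(t)A^\alpha u(t)\quad(0<t<T),\qquad u(0)=x_0,$$ is a function $u:[0,T)\to X$ with $u(0)=x_0$ which is $C^1$ on $(0,T)$, takes values in $D(A^\alpha)$ and satisfies the equation there, and attains its initial value in the sense that $A^{-1}u(t)\to A^{-1}x_0$ as $t\to0^+$ (this holds in particular if $u(t)\to x_0$ in norm). (1) Let $\sigma=-1$. For every coefficient $\varphi$ and every $x_0\in X$ a classical solution exists, and every classical solution satisfies $u(t)=\mathscr T_\alpha\big(\int_0^t\varphi(r)\,dr\big)x_0$ for $0<t<T$. (2) Let $\sigma\in\{1,-1\}$, let $u_0\in D(A^\alpha)$, let $q$ be a bounded linear functional on $X$ (the observation $w\mapsto w(q)$ at a point $q$), and let $h_1,h_2$ be complex-valued functions of $t$ with $h_2(t)\neq0$ for $0<t<T$. Say that a coefficient $\varphi$ *solves the inverse problem with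 data* $(h_1,h_2)$ if there are classical solutions $u$ and $v$ of $$u_t=\sigma\varphi(t)A^\alpha u,\quad u(0)=u_0,\qquad\text{and}\qquad v_t=\sigma\varphi(t)A^\alpha v,\quad v(0)=A^\alpha u_0,$$ with $h_1(t)=q(u(t))$ and $h_2(t)=q(v(t))$ for $0<t<T$. If $(h_1,h_2)$ are such data, i.e. if the inverse problem has some solution, then $h_1$ is differentiable on $(0,T)$ and there is a coefficient $\varphi$ solving the inverse problem, unique on $[0,T)$, and it is given by $$\varphi(t)=\sigma\,\frac{h_1'(t)}{h_2(t)},\qquad 0<t<T.$$ -/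

import Mathlib

open Set Filter Topology MeasureTheory

noncomputable section

namespace AlmostSectorial

variable {X : Type*} [NormedAddCommGroup X] [NormedSpace ℂ X]

/-- `R` is a bounded two-sided inverse of `z - A : D(A) → X`. -/
def IsResolventAt (A : X →ₗ.[ℂ] X) (z : ℂ) (R : X →L[ℂ] X) : Prop :=
  (∀ x : X, ∃ h : R x ∈ A.domain, z • R x - A ⟨R x, h⟩ = x) ∧
    ∀ x : A.domain, R (z • (x : X) - A x) = x

/-- The resolvent set `ρ(A)`. -/
def resolventSet (A : X →ₗ.[ℂ] X) : Set ℂ :=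
  {z | ∃ R : X →L[ℂ] X, IsResolventAt A z R}

/-- The spectrum `σ(A)`. -/
def spectrumSet (A : X →ₗ.[ℂ] X) : Set ℂ := (resolventSet A)ᶜ

open Classical in
/-- The resolvent `(z - A)⁻¹` (zero when `z` lies in the spectrum). -/
def resolvent (A : X →ₗ.[ℂ] X) (z : ℂ) : X →L[ℂ] X :=
  if h : ∃ R : X →L[ℂ] X, IsResolventAt A z R then h.choose else 0

/-- The closed sector `S_μ = {z ≠ 0 : |arg z| ≤ μ} ∪ {0}`. -/
def closedSector (μ : ℝ) : Set ℂ := {z | z ≠ 0 ∧ |z.arg| ≤ μ} ∪ {0}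

/-- The class `Θ_ω^γ(X)` of almost sectorial operators. -/
structure IsAlmostSectorial (γ ω : ℝ) (A : X →ₗ.[ℂ] X) : Prop where
  neg_one_lt : -1 < γ
  lt_zero : γ < 0
  nonneg : 0 ≤ ω
  lt_pi : ω < Real.pi
  closed : A.IsClosed
  spectrum_subset : spectrumSet A ⊆ closedSector ω
  bound : ∀ μ : ℝ, ω < μ → μ < Real.pi → ∃ C : ℝ, 0 < C ∧
    ∀ z : ℂ, z ∉ closedSector μ → ‖resolvent A z‖ ≤ C * ‖z‖ ^ γ

/-- The integral `∫ F(z) dz` over the path `Γ_θ` formed by the two rays `{ρ e^{-iθ}}` and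
`{ρ e^{iθ}}`, `ρ > 0`, oriented so that the sector `|arg z| < θ` lies to the left: the path comes
in from infinity along `e^{iθ}` and goes out to infinity along `e^{-iθ}`. -/
def rayIntegral (θ : ℝ) (F : ℂ → X →L[ℂ] X) : X →L[ℂ] X :=
  (∫ ρ in Ioi (0 : ℝ), Complex.exp (-(θ * Complex.I)) •
      F (ρ * Complex.exp (-(θ * Complex.I)))) -
    ∫ ρ in Ioi (0 : ℝ), Complex.exp (θ * Complex.I) • F (ρ * Complex.exp (θ * Complex.I))

/-- The operator `f(A) = (2πi)⁻¹ ∫_{Γ_θ} f(z) (z - A)⁻¹ dz`, for functions `f` for which the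
integral converges absolutely. -/
def funCalc (A : X →ₗ.[ℂ] X) (θ : ℝ) (f : ℂ → ℂ) : X →L[ℂ] X :=
  (2 * Real.pi * Complex.I : ℂ)⁻¹ • rayIntegral θ (fun z => f z • resolvent A z)

/-- The operators `𝒯_α(t) = e^{-t A^α} = (2πi)⁻¹ ∫_{Γ_θ} e^{-t z^α} (z - A)⁻¹ dz`, for `t > 0`. -/
def semigroupOp (A : X →ₗ.[ℂ] X) (α θ t : ℝ) : X →L[ℂ] X :=
  funCalc A θ (fun z => Complex.exp (-(t * z ^ (α : ℂ))))

/-- The exponent of the regularizer `(1 + z)^{-m}`; it is such that `z^α (1 + z)^{-m}` is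
`O(|z|^{-1})` at infinity, or smaller, for `α > 0`. -/
def regExponent (α : ℝ) : ℕ := ⌊α⌋₊ + 2

/-- The graph of `A^α`: pairs `(x, y)` with `(z^α (1 + z)^{-m})(A) x = (1 + A)^{-m} y`.
Here `(1 + A)⁻¹ = -(-1 - A)⁻¹`. -/
def fracPowGraph (A : X →ₗ.[ℂ] X) (α θ : ℝ) : Submodule ℂ (X × X) where
  carrier := {p | funCalc A θ (fun z => z ^ (α : ℂ) * ((1 + z) ^ regExponent α)⁻¹) p.1 =
    ((-resolvent A (-1)) ^ regExponent α) p.2}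
  add_mem' := by
    intro p p' hp hp'
    simp only [mem_ofPred_eq, Prod.fst_add, Prod.snd_add, map_add] at *
    rw [hp, hp']
  zero_mem' := by
    simp only [mem_ofPred_eq, Prod.fst_zero, Prod.snd_zero, map_zero]
  smul_mem' := by
    intro c p hp
    simp only [mem_ofPred_eq, Prod.smul_fst, Prod.smul_snd, map_smul] at *
    rw [hp]

/-- The fractional power `A^α = ((1 + A)^{-m})⁻¹ (z^α (1 + z)^{-m})(A)`, with its natural domain,
given by the regularized functional calculus of `A`. -/
def fracPow (A : X →ₗ.[ℂ] X) (α θ : ℝ) : X →ₗ.[ℂ] X := (fracPowGraph A α θ).toLinearPMap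

/-- `φ : [0, ∞) → [0, ∞)` is continuous with `φ(t) > 0` for `t > 0`. -/
structure IsCoefficient (φ : ℝ → ℝ) : Prop where
  continuousOn : ContinuousOn φ (Ici 0)
  nonneg : 0 ≤ φ 0
  pos : ∀ t : ℝ, 0 < t → 0 < φ t

/-- `u` is a classical solution of `u_t(t) = c(t) A^α u(t)`, `0 < t < T`, `u(0) = x₀`: it is `C¹` on
`(0, T)`, takes values in `D(A^α)` there and satisfies the equation. The solutions `𝒯_α(·)x₀` need
not be norm-continuous at `0`, so the initial value is required to be attained in the sense
`A⁻¹ u(t) → A⁻¹ x₀` as `t → 0⁺`; solutions with `u(t) → x₀` in norm are included. -/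
structure IsClassicalSolution (A : X →ₗ.[ℂ] X) (α θ T : ℝ) (c : ℝ → ℝ) (x₀ : X) (u : ℝ → X) :
    Prop where
  contDiffOn : ContDiffOn ℝ 1 u (Ioo 0 T)
  equation : ∀ t ∈ Ioo 0 T, ∃ h : u t ∈ (fracPow A α θ).domain,
    HasDerivAt u (c t • fracPow A α θ ⟨u t, h⟩) t
  initial : u 0 = x₀
  attained : Tendsto (fun t => resolvent A 0 (u t)) (𝓝[>] 0) (𝓝 (resolvent A 0 x₀))

/-- `φ` is an admissible coefficient for which the problems `u_t = σ φ A^α u`, `u(0) = u₀` and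
`v_t = σ φ A^α v`, `v(0) = A^α u₀` have classical solutions whose observations are `h₁`, `h₂`. -/
def SolvesInverseProblem (A : X →ₗ.[ℂ] X) (α θ T σ : ℝ) (u₀ : (fracPow A α θ).domain)
    (q : X →L[ℂ] ℂ) (h₁ h₂ : ℝ → ℂ) (φ : ℝ → ℝ) : Prop :=
  IsCoefficient φ ∧ ∃ u v : ℝ → X,
    IsClassicalSolution A α θ T (fun t => σ * φ t) (u₀ : X) u ∧
    IsClassicalSolution A α θ T (fun t => σ * φ t) (fracPow A α θ u₀) v ∧
    ∀ t ∈ Ioo 0 T, h₁ t = q (u t) ∧ h₂ t = q (v t)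

end AlmostSectorial

end

/-! Everything reduces to two facts about the operators `𝒯_α(t)`: if `u` solves the equation and `ψ
> 0` satisfies `ψ' = σφ`, then `𝒯_α(ψ) u` is constant, and each `𝒯_α(t)` with `t > 0` is injective.

Write `Φ(t) = ∫₀ᵗ φ`. For `σ = -1`, the function `s ↦ 𝒯_α(Φ(t) - Φ(s)) u(s)` is constant on `(0, t)`
(`powSemigroup_apply_eq`), and comparing its limits at `s = t` and `s = 0` gives `u(t) = 𝒯_α(Φ(t))
x₀`. For `σ = 1`, the same argument with `Φ(s) - Φ(r)` gives `x₀ = 𝒯_α(Φ(t)) u(t)`. Since `𝒯_α` may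
fail to be strongly continuous at `0`, limits are taken after applying the injective operator `(1 +
A)⁻¹`, where continuity does hold (`tendsto_invOneAdd_mul`).

In the inverse problem, `A^α` commutes with `𝒯_α` on `D(A^α)`, so the two representations yield `v =
A^α u`; for `σ = 1` this requires cancelling `𝒯_α(Φ(t))`, hence injectivity
(`powSemigroup_injective`), which follows from analyticity in a complex sector of times. Then `u' =
σφv`; applying `q` gives `h₁' = σφh₂`, which determines `φ` on `(0, T)`, and continuity determines
it at `0`.

The supporting work is the functional calculus `f ↦ f(A)` for holomorphic `f = O(1/(1 + |z|))` on a
sector. With the resolvent bound `|z|^γ`, `-1 < γ < 0`, the integrals converge absolutely at both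
ends of the rays. Cauchy's theorem for sectors (`ray_eq_ray`), Cauchy's formula (`contour_div_sub`),
the resolvent identity and Fubini give multiplicativity (`funCalc_mul_funCalc`); the identity `(1 +
z)⁻¹(A) = (1 + A)⁻¹` (`funCalc_one_add_inv`) ties the calculus to `A` itself. -/

noncomputable section

namespace AlmostSectorial

/-! ### Polar coordinates and distances between rays -/

section Polar

/-- The point `ρ e^{iy}`. -/
def polar (ρ y : ℝ) : ℂ := ρ * Complex.exp (y * Complex.I)

theorem norm_polar {ρ : ℝ} (hρ : 0 ≤ ρ) (y : ℝ) : ‖polar ρ y‖ = ρ := by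
  rw [polar, norm_mul, Complex.norm_exp_ofReal_mul_I, Complex.norm_real, Real.norm_of_nonneg hρ,
    mul_one]

theorem polar_ne_zero {ρ : ℝ} (hρ : 0 < ρ) (y : ℝ) : polar ρ y ≠ 0 := by
  rw [← norm_pos_iff, norm_polar hρ.le]; exact hρ

theorem arg_polar {ρ y : ℝ} (hρ : 0 < ρ) (hy : |y| < Real.pi) : (polar ρ y).arg = y := by
  rw [polar, Complex.arg_real_mul _ hρ, Complex.exp_mul_I]
  exact Complex.arg_cos_add_sin_mul_I ⟨(abs_lt.1 hy).1, (abs_lt.1 hy).2.le⟩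

theorem polar_mem_slitPlane {ρ y : ℝ} (hρ : 0 < ρ) (hy : |y| < Real.pi) :
    polar ρ y ∈ Complex.slitPlane := by
  rw [Complex.mem_slitPlane_iff_arg, arg_polar hρ hy]
  exact ⟨(abs_lt.1 hy).2.ne, polar_ne_zero hρ y⟩

theorem polar_norm_arg (z : ℂ) : polar ‖z‖ z.arg = z := Complex.norm_mul_exp_arg_mul_I z

theorem exp_add_mul_I (x y : ℝ) :
    Complex.exp (x + y * Complex.I) = polar (Real.exp x) y := by
  rw [polar, Complex.exp_add, Complex.ofReal_exp]

theorem log_polar {ρ y : ℝ} (hρ : 0 < ρ) (hy : |y| < Real.pi) :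
    Complex.log (polar ρ y) = Real.log ρ + y * Complex.I := by
  rw [Complex.log, norm_polar hρ.le, arg_polar hρ hy]

theorem polar_cpow {ρ y : ℝ} (hρ : 0 < ρ) (hy : |y| < Real.pi) (α : ℝ) :
    polar ρ y ^ (α : ℂ) = polar (ρ ^ α) (α * y) := by
  rw [Complex.cpow_def_of_ne_zero (polar_ne_zero hρ y), log_polar hρ hy, polar, Real.rpow_def_of_pos hρ,
    Complex.ofReal_exp, ← Complex.exp_add]
  congr 1; push_cast; ring

theorem normSq_polar_sub (ρ s a b : ℝ) :
    ‖polar ρ a - polar s b‖ ^ 2 = ρ ^ 2 + s ^ 2 - 2 * ρ * s * Real.cos (a - b) := by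
  rw [← Complex.normSq_eq_norm_sq, Complex.normSq_apply, Real.cos_sub]
  simp only [polar, Complex.exp_mul_I, ← Complex.ofReal_cos, ← Complex.ofReal_sin,
    Complex.sub_re, Complex.sub_im, Complex.add_re,
    Complex.add_im, Complex.ofReal_re, Complex.ofReal_im, Complex.mul_re, Complex.mul_im,
    Complex.I_re, Complex.I_im]
  have h1 := Real.sin_sq_add_cos_sq a
  have h2 := Real.sin_sq_add_cos_sq b
  linear_combination ρ ^ 2 * h1 + s ^ 2 * h2

/-- Points whose arguments stay apart are as far apart as their moduli allow. -/
theorem exists_mul_le_norm_polar_sub {δ : ℝ} (hδ : 0 < δ) (hδ' : δ ≤ Real.pi) :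
    ∃ c : ℝ, 0 < c ∧ ∀ ρ s a b : ℝ, 0 ≤ ρ → 0 ≤ s → δ ≤ |a - b| → |a - b| ≤ 2 * Real.pi - δ →
      c * (ρ + s) ≤ ‖polar ρ a - polar s b‖ := by
  have hk : Real.cos δ < 1 := by
    rw [← Real.cos_zero]
    exact Real.cos_lt_cos_of_nonneg_of_le_pi le_rfl hδ' hδ
  -- With `k = cos δ`, the choice comes from `ρ² + s² - 2kρs - (1 - k)/2 · (ρ + s)² = (1 + k)/2 · (ρ
  -- - s)² ≥ 0`.
  refine ⟨√((1 - Real.cos δ) / 2), Real.sqrt_pos.2 (by linarith), ?_⟩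
  intro ρ s a b hρ hs h1 h2
  have hcos : Real.cos (a - b) ≤ Real.cos δ := by
    rw [← Real.cos_abs (a - b)]
    rcases le_total |a - b| Real.pi with h | h
    · exact Real.cos_le_cos_of_nonneg_of_le_pi hδ.le h h1
    · rw [← Real.cos_two_pi_sub |a - b|]
      exact Real.cos_le_cos_of_nonneg_of_le_pi hδ.le (by linarith) (by linarith)
  refine abs_le_of_sq_le_sq' ?_ (norm_nonneg _) |>.2
  rw [mul_pow, Real.sq_sqrt (by linarith), normSq_polar_sub]
  nlinarith [mul_nonneg (mul_nonneg hρ hs) (sub_nonneg.2 hcos), sq_nonneg (ρ - s),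
    Real.neg_one_le_cos δ]

theorem polar_one_pi : polar 1 Real.pi = -1 := by
  rw [polar, Complex.exp_pi_mul_I, Complex.ofReal_one, one_mul]

/-- The point `-1` has argument `π`, which stays at angular distance at least `π - μ` from the
sector. -/
theorem exists_mul_le_norm_one_add_polar {μ : ℝ} (hμ : 0 ≤ μ) (hμ' : μ < Real.pi) :
    ∃ c : ℝ, 0 < c ∧ ∀ ρ y : ℝ, 0 ≤ ρ → |y| ≤ μ → c * (1 + ρ) ≤ ‖1 + polar ρ y‖ := by
  obtain ⟨c, hc, h⟩ := exists_mul_le_norm_polar_sub (sub_pos.2 hμ') (by linarith)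
  refine ⟨c, hc, fun ρ y hρ hy => ?_⟩
  have hy' := abs_le.1 hy
  have := h ρ 1 y Real.pi hρ zero_le_one
    (by rw [abs_sub_comm, abs_of_nonneg (by linarith)]; linarith)
    (by rw [abs_sub_comm, abs_of_nonneg (by linarith)]; linarith)
  rwa [polar_one_pi, sub_neg_eq_add, add_comm (polar ρ y), add_comm ρ] at this

end Polar

/-! ### The integrable majorant on a ray -/

section Weight

/-- The weight `ρ^β / (1 + ρ)`, which is integrable on `(0, ∞)` for `-1 < β < 0`. -/
def weight (β ρ : ℝ) : ℝ := ρ ^ β / (1 + ρ)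

theorem weight_nonneg (β : ℝ) {ρ : ℝ} (hρ : 0 ≤ ρ) : 0 ≤ weight β ρ := by
  unfold weight; positivity

theorem continuousOn_weight (β : ℝ) : ContinuousOn (weight β) (Ioi 0) := by
  intro ρ hρ
  have hρ : 0 < ρ := hρ
  refine ContinuousAt.continuousWithinAt ?_
  unfold weight
  refine (Real.continuousAt_rpow_const _ _ (Or.inl hρ.ne')).div (by fun_prop) (by positivity)

theorem integrableOn_weight {β : ℝ} (h1 : -1 < β) (h0 : β < 0) :
    IntegrableOn (weight β) (Ioi 0) := by
  rw [← Ioc_union_Ioi_eq_Ioi zero_le_one]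
  refine IntegrableOn.union ?_ ?_
  · have h : IntegrableOn (fun ρ : ℝ => ρ ^ β) (Ioc 0 1) := by
      rw [← intervalIntegrable_iff_integrableOn_Ioc_of_le zero_le_one]
      exact intervalIntegral.intervalIntegrable_rpow' h1
    refine Integrable.mono' h (((continuousOn_weight β).mono Ioc_subset_Ioi_self)
      |>.aestronglyMeasurable measurableSet_Ioc) ?_
    refine (ae_restrict_iff' measurableSet_Ioc).2 (ae_of_all _ fun ρ hρ => ?_)
    rw [Real.norm_of_nonneg (weight_nonneg β hρ.1.le)]
    exact div_le_self (Real.rpow_nonneg hρ.1.le _) (by linarith [hρ.1])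
  · have h : IntegrableOn (fun ρ : ℝ => ρ ^ (β - 1)) (Ioi 1) :=
      integrableOn_Ioi_rpow_of_lt (by linarith) zero_lt_one
    refine Integrable.mono' h (((continuousOn_weight β).mono (Ioi_subset_Ioi zero_le_one))
      |>.aestronglyMeasurable measurableSet_Ioi) ?_
    refine (ae_restrict_iff' measurableSet_Ioi).2 (ae_of_all _ fun ρ hρ => ?_)
    have hρ : 1 < ρ := hρ
    have h0 : 0 < ρ := by linarith
    rw [Real.norm_of_nonneg (weight_nonneg β h0.le), weight, Real.rpow_sub_one h0.ne']
    exact div_le_div_of_nonneg_left (Real.rpow_nonneg h0.le _) h0 (by linarith)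

/-- `1/(1+ρ)² ≤ ρ^β/(1+ρ)`. -/
theorem one_div_sq_le_weight {β ρ : ℝ} (h1 : -1 < β) (h0 : β < 0) (hρ : 0 < ρ) :
    1 / (1 + ρ) / (1 + ρ) ≤ weight β ρ := by
  unfold weight
  gcongr
  rw [div_le_iff₀ (by positivity)]
  rcases le_total ρ 1 with h | h
  · have := Real.one_le_rpow_of_pos_of_le_one_of_nonpos hρ h h0.le
    nlinarith
  · have h2 := Real.rpow_le_rpow_of_exponent_le h h1.le
    rw [Real.rpow_neg_one] at h2
    have h3 : ρ⁻¹ * ρ = 1 := inv_mul_cancel₀ hρ.ne'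
    nlinarith [Real.rpow_nonneg hρ.le β]

/-- In the variable `ρ = e^x`, this and the next limit make the arcs at `∞` and at `0` disappear
when a ray is turned. -/
theorem tendsto_exp_mul_weight_atTop {β : ℝ} (h0 : β < 0) :
    Tendsto (fun x => Real.exp x * weight β (Real.exp x)) atTop (𝓝 0) := by
  have hlim : Tendsto (fun x : ℝ => Real.exp (β * x)) atTop (𝓝 0) :=
    Real.tendsto_exp_atBot.comp (tendsto_id.const_mul_atTop_of_neg h0)
  refine squeeze_zero (fun x => mul_nonneg (Real.exp_nonneg _)
    (weight_nonneg _ (Real.exp_nonneg _))) (fun x => ?_) hlim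
  rw [weight, ← Real.exp_mul, mul_comm x β, ← mul_div_assoc, div_le_iff₀ (by positivity)]
  nlinarith [Real.exp_pos x, Real.exp_pos (β * x)]

theorem tendsto_exp_mul_weight_atBot {β : ℝ} (h1 : -1 < β) :
    Tendsto (fun x => Real.exp x * weight β (Real.exp x)) atBot (𝓝 0) := by
  have hlim : Tendsto (fun x : ℝ => Real.exp ((1 + β) * x)) atBot (𝓝 0) :=
    Real.tendsto_exp_atBot.comp (tendsto_id.const_mul_atBot (by linarith))
  refine squeeze_zero (fun x => mul_nonneg (Real.exp_nonneg _)
    (weight_nonneg _ (Real.exp_nonneg _))) (fun x => ?_) hlim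
  rw [weight, ← Real.exp_mul, mul_comm x β, ← mul_div_assoc, ← Real.exp_add]
  refine (div_le_self (Real.exp_nonneg _) (by linarith [Real.exp_pos x])).trans (le_of_eq ?_)
  congr 1; ring

end Weight

/-! ### Integrals along rays, Cauchy's theorem for sectors, Fubini -/

section Ray

variable {E F : Type*} [NormedAddCommGroup E] [NormedSpace ℂ E]
  [NormedAddCommGroup F] [NormedSpace ℂ F]

/-- The integral of `F` along the ray of argument `a`, outwards. -/
def ray (a : ℝ) (F : ℂ → E) : E :=
  ∫ ρ in Ioi (0 : ℝ), Complex.exp (a * Complex.I) • F (polar ρ a)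

/-- Integrability along the ray of argument `a`. -/
def RayIntegrable (a : ℝ) (F : ℂ → E) : Prop := IntegrableOn (fun ρ => F (polar ρ a)) (Ioi 0)

theorem ray_add {a : ℝ} {F G : ℂ → E} (hF : RayIntegrable a F) (hG : RayIntegrable a G) :
    ray a (fun z => F z + G z) = ray a F + ray a G := by
  simp only [ray, smul_add]
  exact integral_add (hF.smul _) (hG.smul _)

theorem ray_sub {a : ℝ} {F G : ℂ → E} (hF : RayIntegrable a F) (hG : RayIntegrable a G) :
    ray a (fun z => F z - G z) = ray a F - ray a G := by
  simp only [ray, smul_sub]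
  exact integral_sub (hF.smul _) (hG.smul _)

theorem ray_smul (a : ℝ) (c : ℂ) (F : ℂ → E) : ray a (fun z => c • F z) = c • ray a F := by
  simp only [ray, smul_comm _ c, integral_smul]

theorem ray_congr {a : ℝ} {F G : ℂ → E} (h : ∀ ρ, 0 < ρ → F (polar ρ a) = G (polar ρ a)) :
    ray a F = ray a G :=
  setIntegral_congr_fun measurableSet_Ioi fun ρ hρ => by simp only [h ρ hρ]

theorem map_ray [CompleteSpace E] [CompleteSpace F] (L : E →L[ℂ] F) {a : ℝ}
    {G : ℂ → E} (hG : RayIntegrable a G) : L (ray a G) = ray a (fun z => L (G z)) := by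
  simp only [ray]
  rw [← L.integral_comp_comm (φ := fun ρ => Complex.exp (a * Complex.I) • G (polar ρ a))
    (hG.smul _)]
  simp only [map_smul]

theorem RayIntegrable.clm_apply (L : E →L[ℂ] F) {a : ℝ} {G : ℂ → E} (hG : RayIntegrable a G) :
    RayIntegrable a (fun z => L (G z)) :=
  L.integrable_comp hG

theorem continuous_polar (a : ℝ) : Continuous (fun ρ => polar ρ a) := by
  unfold polar; fun_prop

theorem rayIntegrable_of_bound {E : Type*} [NormedAddCommGroup E] {a C β : ℝ} {F : ℂ → E} (h1 : -1 < β) (h0 : β < 0)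
    (hc : ∀ ρ, 0 < ρ → ContinuousAt F (polar ρ a))
    (hb : ∀ ρ, 0 < ρ → ‖F (polar ρ a)‖ ≤ C * weight β ρ) : RayIntegrable a F := by
  refine Integrable.mono' ((integrableOn_weight h1 h0).const_mul C) ?_ ?_
  · refine ContinuousOn.aestronglyMeasurable (fun ρ hρ => ?_) measurableSet_Ioi
    exact (ContinuousAt.comp (f := fun ρ => polar ρ a) (hc ρ hρ)
      (continuous_polar a).continuousAt).continuousWithinAt
  · exact (ae_restrict_iff' measurableSet_Ioi).2 (ae_of_all _ hb)

theorem image_exp_univ : Real.exp '' univ = Ioi 0 := by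
  rw [image_univ, Real.range_exp]

/-- The substitution `ρ = e^x` turns the ray into the horizontal line of height `a`, so that sectors
become strips and Cauchy's theorem for rectangles applies. -/
theorem ray_eq_integral_exp (a : ℝ) (F : ℂ → E) :
    ray a F = ∫ x : ℝ, Complex.exp (x + a * Complex.I) • F (Complex.exp (x + a * Complex.I)) := by
  have := integral_image_eq_integral_abs_deriv_smul (s := univ) MeasurableSet.univ
    (fun x _ => (Real.hasDerivAt_exp x).hasDerivWithinAt) Real.exp_injective.injOn
    (fun ρ => Complex.exp (a * Complex.I) • F (polar ρ a))
  rw [ray, ← image_exp_univ, this, setIntegral_univ]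
  refine integral_congr_ae (ae_of_all _ fun x => ?_)
  simp only [exp_add_mul_I, abs_of_pos (Real.exp_pos x)]
  rw [← Complex.coe_smul, smul_smul, polar]

theorem RayIntegrable.integrable_exp {a : ℝ} {F : ℂ → E} (h : RayIntegrable a F) :
    Integrable fun x : ℝ =>
      Complex.exp (x + a * Complex.I) • F (Complex.exp (x + a * Complex.I)) := by
  have := integrableOn_image_iff_integrableOn_abs_deriv_smul (s := univ) MeasurableSet.univ
    (fun x _ => (Real.hasDerivAt_exp x).hasDerivWithinAt) Real.exp_injective.injOn
    (fun ρ => Complex.exp (a * Complex.I) • F (polar ρ a))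
  rw [image_exp_univ, integrableOn_univ] at this
  refine (this.1 (h.smul _)).congr (ae_of_all _ fun x => ?_)
  simp only [exp_add_mul_I, abs_of_pos (Real.exp_pos x)]
  rw [← Complex.coe_smul, smul_smul, polar]

/-- Cauchy's theorem for a sector: the integral along a ray does not change when the ray is
turned through a sector where the integrand is holomorphic and small near `0` and `∞`. -/
theorem ray_eq_ray [CompleteSpace E] {a b C β r R : ℝ} (hab : a ≤ b) {F : ℂ → E}
    (h1 : -1 < β) (h0 : β < 0) (hr : 0 < r)
    (hd : ∀ y ∈ Icc a b, ∀ ρ, 0 < ρ → DifferentiableAt ℂ F (polar ρ y))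
    (hb : ∀ y ∈ Icc a b, ∀ ρ, 0 < ρ → ρ < r ∨ R < ρ → ‖F (polar ρ y)‖ ≤ C * weight β ρ)
    (ha : RayIntegrable a F) (hb' : RayIntegrable b F) : ray a F = ray b F := by
  set G : ℂ → E := fun w => Complex.exp w • F (Complex.exp w) with hG
  have hGd : ∀ w : ℂ, w.im ∈ Icc a b → DifferentiableAt ℂ G w := by
    intro w hw
    have hw' : Complex.exp w = polar (Real.exp w.re) w.im := by
      rw [← exp_add_mul_I, Complex.re_add_im]
    have h2 : DifferentiableAt ℂ F (Complex.exp w) := by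
      rw [hw']; exact hd _ hw _ (Real.exp_pos _)
    have h3 : DifferentiableAt ℂ (fun w => F (Complex.exp w)) w :=
      DifferentiableAt.comp (g := F) (f := Complex.exp) w h2 Complex.differentiableAt_exp
    exact Complex.differentiableAt_exp.smul h3
  -- The bound on `F` is available only near `0` and `∞`. This suffices for the vertical sides and
  -- leaves `F` free to be large at intermediate radii, for instance near a removed pole.
  have hnorm : ∀ x y : ℝ, y ∈ Icc a b → Real.exp x < r ∨ R < Real.exp x →
      ‖G (x + y * Complex.I)‖ ≤ C * (Real.exp x * weight β (Real.exp x)) := by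
    intro x y hy hx
    have h2 := hb y hy _ (Real.exp_pos x) hx
    simp only [hG, exp_add_mul_I]
    rw [norm_smul, norm_polar (Real.exp_nonneg x)]
    calc _ ≤ Real.exp x * (C * weight β (Real.exp x)) := by gcongr
      _ = _ := by ring
  have hside : ∀ (l : Filter ℝ) (f : ℝ → ℝ),
      Tendsto (fun n => Real.exp (f n) * weight β (Real.exp (f n))) l (𝓝 0) →
      (∀ᶠ n in l, Real.exp (f n) < r ∨ R < Real.exp (f n)) →
      Tendsto (fun n : ℝ => ∫ y in a..b, G (f n + y * Complex.I)) l (𝓝 0) := by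
    intro l f hf hev
    refine squeeze_zero_norm' (a := fun n => C * (Real.exp (f n) * weight β (Real.exp (f n))) *
      |b - a|) ?_ (by simpa using (hf.const_mul C).mul_const |b - a|)
    filter_upwards [hev] with n hn
    refine intervalIntegral.norm_integral_le_of_norm_le_const fun y hy => ?_
    rw [uIoc_of_le hab] at hy
    exact hnorm _ y ⟨hy.1.le, hy.2⟩ hn
  have htop := hside atTop id (tendsto_exp_mul_weight_atTop h0)
    ((Real.tendsto_exp_atTop.eventually_gt_atTop R).mono fun _ h => Or.inr h)
  have hbot := hside atTop (fun n => -n)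
    ((tendsto_exp_mul_weight_atBot h1).comp tendsto_neg_atTop_atBot)
    (((Real.tendsto_exp_atBot.comp tendsto_neg_atTop_atBot).eventually_lt_const hr).mono
      fun _ h => Or.inl h)
  have hA := intervalIntegral_tendsto_integral (μ := volume) ha.integrable_exp
    tendsto_neg_atTop_atBot tendsto_id
  have hB := intervalIntegral_tendsto_integral (μ := volume) hb'.integrable_exp
    tendsto_neg_atTop_atBot tendsto_id
  rw [← ray_eq_integral_exp] at hA hB
  -- Cauchy's theorem on the rectangle `[-n, n] × [a, b]`; as `n → ∞` the horizontal sides tend to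
  -- the two ray integrals and the vertical ones to `0`.
  have hrect : ∀ n : ℝ, (∫ x in (-n)..n, G (x + a * Complex.I)) -
      (∫ x in (-n)..n, G (x + b * Complex.I)) +
      Complex.I • (∫ y in a..b, G ((n : ℝ) + y * Complex.I)) -
      Complex.I • (∫ y in a..b, G ((-n : ℝ) + y * Complex.I)) = 0 := by
    intro n
    have := Complex.integral_boundary_rect_eq_zero_of_differentiableOn G
      (⟨-n, a⟩ : ℂ) (⟨n, b⟩ : ℂ) (fun w hw => (hGd w ?_).differentiableWithinAt)
    · simpa using this
    · have := hw.2
      simpa [uIcc_of_le hab] using this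
  have hlim := ((hA.sub hB).add (htop.const_smul Complex.I)).sub (hbot.const_smul Complex.I)
  have hz := tendsto_nhds_unique hlim (tendsto_const_nhds.congr fun n => (hrect n).symm)
  simpa [sub_eq_zero] using hz

/-- The integral `(2πi)⁻¹ ∫_{Γ_θ} F(z) dz`. -/
def contour (θ : ℝ) (F : ℂ → E) : E :=
  (2 * Real.pi * Complex.I : ℂ)⁻¹ • (ray (-θ) F - ray θ F)

/-- Integrability along `Γ_θ`. -/
def ContourIntegrable (θ : ℝ) (F : ℂ → E) : Prop := ∀ a : ℝ, |a| = θ → RayIntegrable a F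

theorem contour_add {θ : ℝ} (hθ : 0 ≤ θ) {F G : ℂ → E} (hF : ContourIntegrable θ F)
    (hG : ContourIntegrable θ G) :
    contour θ (fun z => F z + G z) = contour θ F + contour θ G := by
  have h1 : |-θ| = θ := by rw [abs_neg, abs_of_nonneg hθ]
  have h2 : |θ| = θ := abs_of_nonneg hθ
  simp only [contour]
  rw [ray_add (hF _ h1) (hG _ h1), ray_add (hF _ h2) (hG _ h2), ← smul_add]
  congr 1; abel

theorem contour_sub {θ : ℝ} (hθ : 0 ≤ θ) {F G : ℂ → E} (hF : ContourIntegrable θ F)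
    (hG : ContourIntegrable θ G) :
    contour θ (fun z => F z - G z) = contour θ F - contour θ G := by
  have h1 : |-θ| = θ := by rw [abs_neg, abs_of_nonneg hθ]
  have h2 : |θ| = θ := abs_of_nonneg hθ
  simp only [contour]
  rw [ray_sub (hF _ h1) (hG _ h1), ray_sub (hF _ h2) (hG _ h2), ← smul_sub]
  congr 1; abel

theorem contour_smul (θ : ℝ) (c : ℂ) (F : ℂ → E) :
    contour θ (fun z => c • F z) = c • contour θ F := by
  simp only [contour, ray_smul, ← smul_sub, smul_comm _ c]

theorem contour_congr {θ : ℝ} (hθ : 0 ≤ θ) {F G : ℂ → E}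
    (h : ∀ a : ℝ, |a| = θ → ∀ ρ, 0 < ρ → F (polar ρ a) = G (polar ρ a)) :
    contour θ F = contour θ G := by
  rw [contour, contour, ray_congr (h (-θ) (by rw [abs_neg, abs_of_nonneg hθ])),
    ray_congr (h θ (abs_of_nonneg hθ))]

theorem map_contour [CompleteSpace E] [CompleteSpace F] (L : E →L[ℂ] F) {θ : ℝ} (hθ : 0 ≤ θ)
    {G : ℂ → E} (hG : ContourIntegrable θ G) :
    L (contour θ G) = contour θ (fun z => L (G z)) := by
  rw [contour, contour, map_smul, map_sub,
    map_ray L (hG _ (by rw [abs_neg, abs_of_nonneg hθ])),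
    map_ray L (hG _ (abs_of_nonneg hθ))]

theorem funCalc_eq_contour {X : Type*} [NormedAddCommGroup X] [NormedSpace ℂ X]
    (A : X →ₗ.[ℂ] X) (θ : ℝ) (f : ℂ → ℂ) :
    funCalc A θ f = contour θ (fun z => f z • resolvent A z) := by
  simp only [funCalc, rayIntegral, contour, ray, polar, Complex.ofReal_neg, neg_mul]

/-- A product of two integrable weights dominates the kernel; this is the hypothesis of Fubini's
theorem. -/
theorem integrable_prod_of_bound {a b C β : ℝ} (h1 : -1 < β) (h0 : β < 0) {K : ℂ → ℂ → E}
    (hc : ∀ ρ s, 0 < ρ → 0 < s →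
      ContinuousAt (fun p : ℂ × ℂ => K p.1 p.2) (polar ρ a, polar s b))
    (hb : ∀ ρ s, 0 < ρ → 0 < s → ‖K (polar ρ a) (polar s b)‖ ≤ C * (weight β ρ * weight β s)) :
    Integrable (fun p : ℝ × ℝ => Complex.exp (a * Complex.I) •
      Complex.exp (b * Complex.I) • K (polar p.1 a) (polar p.2 b))
      ((volume.restrict (Ioi 0)).prod (volume.restrict (Ioi 0))) := by
  refine (Integrable.smul _ (Integrable.smul _ ?_))
  refine Integrable.mono' (((integrableOn_weight h1 h0).mul_prod
    (integrableOn_weight h1 h0)).const_mul C) ?_ ?_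
  · rw [Measure.prod_restrict]
    refine ContinuousOn.aestronglyMeasurable (fun p hp => ?_)
      (measurableSet_Ioi.prod measurableSet_Ioi)
    refine (ContinuousAt.comp (f := fun p : ℝ × ℝ => (polar p.1 a, polar p.2 b))
      (hc p.1 p.2 hp.1 hp.2) ?_).continuousWithinAt
    exact (((continuous_polar a).comp continuous_fst).prodMk
      ((continuous_polar b).comp continuous_snd)).continuousAt
  · rw [Measure.prod_restrict]
    exact (ae_restrict_iff' (measurableSet_Ioi.prod measurableSet_Ioi)).2
      (ae_of_all _ fun p hp => hb p.1 p.2 hp.1 hp.2)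

/-- Integrals along two rays may be interchanged. -/
theorem ray_ray_swap {a b C β : ℝ} (h1 : -1 < β) (h0 : β < 0) {K : ℂ → ℂ → E}
    (hc : ∀ ρ s, 0 < ρ → 0 < s →
      ContinuousAt (fun p : ℂ × ℂ => K p.1 p.2) (polar ρ a, polar s b))
    (hb : ∀ ρ s, 0 < ρ → 0 < s → ‖K (polar ρ a) (polar s b)‖ ≤ C * (weight β ρ * weight β s)) :
    ray a (fun z => ray b (fun w => K z w)) = ray b (fun w => ray a (fun z => K z w)) := by
  have := integral_integral_swap (f := fun ρ s : ℝ => Complex.exp (a * Complex.I) •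
    Complex.exp (b * Complex.I) • K (polar ρ a) (polar s b)) (integrable_prod_of_bound h1 h0 hc hb)
  simp only [ray, ← integral_smul]
  rw [this]
  simp only [smul_comm (Complex.exp (a * Complex.I)) (Complex.exp (b * Complex.I))]

theorem rayIntegrable_ray {a b C β : ℝ} (h1 : -1 < β) (h0 : β < 0) {K : ℂ → ℂ → E}
    (hc : ∀ ρ s, 0 < ρ → 0 < s →
      ContinuousAt (fun p : ℂ × ℂ => K p.1 p.2) (polar ρ a, polar s b))
    (hb : ∀ ρ s, 0 < ρ → 0 < s → ‖K (polar ρ a) (polar s b)‖ ≤ C * (weight β ρ * weight β s)) :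
    RayIntegrable a (fun z => ray b (fun w => K z w)) := by
  have := ((integrable_prod_of_bound h1 h0 hc hb).integral_prod_left).smul
    (Complex.exp (a * Complex.I))⁻¹
  refine this.congr (ae_of_all _ fun ρ => ?_)
  simp only [Pi.smul_apply, ray, integral_smul]
  rw [smul_smul, inv_mul_cancel₀ (Complex.exp_ne_zero _), one_smul]

/-- Integrals along two contours may be interchanged. -/
theorem contour_contour_swap {θ θ' C β : ℝ} (hθ : 0 ≤ θ) (hθ' : 0 ≤ θ') (h1 : -1 < β) (h0 : β < 0)
    {K : ℂ → ℂ → E}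
    (hc : ∀ a b : ℝ, |a| = θ → |b| = θ' → ∀ ρ s, 0 < ρ → 0 < s →
      ContinuousAt (fun p : ℂ × ℂ => K p.1 p.2) (polar ρ a, polar s b))
    (hb : ∀ a b : ℝ, |a| = θ → |b| = θ' → ∀ ρ s, 0 < ρ → 0 < s →
      ‖K (polar ρ a) (polar s b)‖ ≤ C * (weight β ρ * weight β s)) :
    contour θ (fun z => contour θ' (fun w => K z w)) =
      contour θ' (fun w => contour θ (fun z => K z w)) := by
  have hc' : ∀ b a : ℝ, |b| = θ' → |a| = θ → ∀ s ρ, 0 < s → 0 < ρ →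
      ContinuousAt (fun p : ℂ × ℂ => K p.2 p.1) (polar s b, polar ρ a) :=
    fun b a hb ha s ρ hs hρ => ContinuousAt.comp (x := (polar s b, polar ρ a))
      (f := fun p : ℂ × ℂ => (p.2, p.1)) (g := fun p : ℂ × ℂ => K p.1 p.2)
      (hc a b ha hb ρ s hρ hs) continuous_swap.continuousAt
  have hb' : ∀ b a : ℝ, |b| = θ' → |a| = θ → ∀ s ρ, 0 < s → 0 < ρ →
      ‖K (polar ρ a) (polar s b)‖ ≤ C * (weight β s * weight β ρ) :=
    fun b a h2 h3 s ρ hs hρ => by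
      rw [mul_comm (weight β s)]; exact hb a b h3 h2 ρ s hρ hs
  have n1 : |-θ| = θ := by rw [abs_neg, abs_of_nonneg hθ]
  have p1 : |θ| = θ := abs_of_nonneg hθ
  have n2 : |-θ'| = θ' := by rw [abs_neg, abs_of_nonneg hθ']
  have p2 : |θ'| = θ' := abs_of_nonneg hθ'
  have hi := fun a b h2 h3 => rayIntegrable_ray h1 h0 (hc a b h2 h3) (hb a b h2 h3)
  have hi' := fun b a h2 h3 => rayIntegrable_ray (K := fun w z => K z w) h1 h0
    (hc' b a h2 h3) (hb' b a h2 h3)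
  have hsw := fun a b h2 h3 => ray_ray_swap h1 h0 (hc a b h2 h3) (hb a b h2 h3)
  simp only [contour, ray_smul]
  rw [ray_sub (hi _ _ n1 n2) (hi _ _ n1 p2), ray_sub (hi _ _ p1 n2) (hi _ _ p1 p2),
    ray_sub (hi' _ _ n2 n1) (hi' _ _ n2 p1), ray_sub (hi' _ _ p2 n1) (hi' _ _ p2 p1),
    hsw _ _ n1 n2, hsw _ _ n1 p2, hsw _ _ p1 n2, hsw _ _ p1 p2]
  rw [← smul_sub, ← smul_sub]
  congr 2
  abel

end Ray

/-! ### Resolvents of almost sectorial operators -/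

section Resolvent

variable {X : Type*} [NormedAddCommGroup X] [NormedSpace ℂ X] {A : X →ₗ.[ℂ] X}

theorem IsResolventAt.exists_domain {z : ℂ} {R : X →L[ℂ] X} (hR : IsResolventAt A z R) (x : X) :
    ∃ y : A.domain, R x = y ∧ z • (y : X) - A y = x := by
  obtain ⟨h, hx⟩ := hR.1 x
  exact ⟨⟨R x, h⟩, rfl, hx⟩

theorem IsResolventAt.unique {z : ℂ} {R S : X →L[ℂ] X} (hR : IsResolventAt A z R)
    (hS : IsResolventAt A z S) : R = S := by
  ext x
  obtain ⟨y, hy, hx⟩ := hR.exists_domain x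
  have := hS.2 y
  rw [hx] at this
  rw [hy, this]

theorem isResolventAt_resolvent {z : ℂ} (hz : z ∈ resolventSet A) :
    IsResolventAt A z (resolvent A z) := by
  have h : ∃ R : X →L[ℂ] X, IsResolventAt A z R := hz
  rw [resolvent, dif_pos h]
  exact h.choose_spec

theorem IsResolventAt.eq_resolvent {z : ℂ} {R : X →L[ℂ] X} (hR : IsResolventAt A z R) :
    resolvent A z = R :=
  (isResolventAt_resolvent ⟨R, hR⟩).unique hR

theorem resolvent_injective {z : ℂ} (hz : z ∈ resolventSet A) :
    Function.Injective (resolvent A z) := by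
  refine (injective_iff_map_eq_zero _).2 fun x hx => ?_
  obtain ⟨y, hy, hyx⟩ := (isResolventAt_resolvent hz).exists_domain x
  have h0 : y = 0 := Subtype.ext (hy.symm.trans hx)
  rw [← hyx, h0, LinearPMap.map_zero, Submodule.coe_zero, smul_zero, sub_zero]

/-- The resolvent identity. -/
theorem smul_resolvent_mul_resolvent {z w : ℂ} (hz : z ∈ resolventSet A)
    (hw : w ∈ resolventSet A) :
    (w - z) • (resolvent A z * resolvent A w) = resolvent A z - resolvent A w := by
  ext x
  obtain ⟨y, hy, hyx⟩ := (isResolventAt_resolvent hw).exists_domain x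
  have h2 := (isResolventAt_resolvent hz).2 y
  have h3 : z • (y : X) - A y = x - (w - z) • (y : X) := by
    rw [sub_smul, ← hyx]; abel
  rw [h3, map_sub, map_smul, sub_eq_iff_eq_add] at h2
  change (w - z) • resolvent A z (resolvent A w x) = resolvent A z x - resolvent A w x
  rw [h2, hy]; abel

theorem resolvent_mul_resolvent {z w : ℂ} (hz : z ∈ resolventSet A)
    (hw : w ∈ resolventSet A) (hzw : w ≠ z) :
    resolvent A z * resolvent A w = (w - z)⁻¹ • (resolvent A z - resolvent A w) := by
  rw [← smul_resolvent_mul_resolvent hz hw, smul_smul, inv_mul_cancel₀ (sub_ne_zero.2 hzw),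
    one_smul]

/-- From `w - A = (1 + (w - z)R)(z - A)`. Combined with the Neumann series it gives openness of
`ρ(A)` and, through differentiability of inversion, holomorphy of the resolvent. -/
theorem isResolventAt_of_isUnit {z w : ℂ} {R : X →L[ℂ] X} (hR : IsResolventAt A z R)
    (h : IsUnit (1 + (w - z) • R)) :
    IsResolventAt A w (R * Ring.inverse (1 + (w - z) • R)) := by
  have h1 := Ring.mul_inverse_cancel _ h
  have h2 := Ring.inverse_mul_cancel _ h
  set B := Ring.inverse (1 + (w - z) • R)
  have hcomm : R * B = B * R := by
    calc R * B = B * (1 + (w - z) • R) * (R * B) := by rw [h2, one_mul]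
      _ = B * R * ((1 + (w - z) • R) * B) := by
        simp only [mul_add, add_mul, mul_one, one_mul, smul_mul_assoc, mul_smul_comm, mul_assoc]
      _ = B * R := by rw [h1, mul_one]
  constructor
  · intro x
    obtain ⟨y, hy, hyx⟩ := hR.exists_domain (B x)
    have hm : (R * B) x = y := hy
    have h3 : B x + (w - z) • R (B x) = x := congrArg (fun T : X →L[ℂ] X => T x) h1
    refine ⟨hm ▸ y.2, ?_⟩
    have h5 : ∀ h', A ⟨(R * B) x, h'⟩ = A y := fun h' => congrArg A (Subtype.ext hm)
    rw [h5, hm]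
    rw [hy, sub_smul, ← hyx] at h3
    rw [← h3]; abel_nf
  · intro x
    have h3 : B ((x : X) + (w - z) • R x) = x := congrArg (fun T : X →L[ℂ] X => T (x : X)) h2
    have h4 := hR.2 x
    rw [hcomm]
    change B (R (w • (x : X) - A x)) = x
    have h5 : w • (x : X) - A x = (z • (x : X) - A x) + (w - z) • (x : X) := by
      rw [sub_smul]; abel
    rw [h5, map_add, h4, map_smul, h3]

/-- The angle `y` may exceed `π`, because a contour will later be turned across the negative axis.
Comparing cosines avoids having to reduce `y` to the principal argument. -/
theorem polar_notMem_closedSector {μ ρ y : ℝ} (hρ : 0 < ρ) (hμ : 0 ≤ μ) (h : μ < |y|)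
    (h' : |y| < 2 * Real.pi - μ) : polar ρ y ∉ closedSector μ := by
  have hμ' : μ < Real.pi := by linarith
  rintro (⟨h0, hz⟩ | h0)
  · have h1 : Real.cos (polar ρ y).arg = Real.cos y := by
      rw [Complex.cos_arg h0, norm_polar hρ.le, polar, Complex.re_ofReal_mul,
        Complex.exp_ofReal_mul_I_re, mul_div_cancel_left₀ _ hρ.ne']
    have h2 : Real.cos μ ≤ Real.cos (polar ρ y).arg := by
      rw [← Real.cos_abs (polar ρ y).arg]
      exact Real.cos_le_cos_of_nonneg_of_le_pi (abs_nonneg _) hμ'.le hz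
    have h3 : Real.cos y < Real.cos μ := by
      rw [← Real.cos_abs y]
      rcases le_total |y| Real.pi with h4 | h4
      · exact Real.cos_lt_cos_of_nonneg_of_le_pi hμ h4 h
      · rw [← Real.cos_two_pi_sub |y|]
        exact Real.cos_lt_cos_of_nonneg_of_le_pi hμ (by linarith) (by linarith)
    linarith
  · exact polar_ne_zero hρ y h0

variable {γ ω : ℝ}

theorem IsAlmostSectorial.polar_mem_resolventSet (hA : IsAlmostSectorial γ ω A) {ρ y : ℝ}
    (hρ : 0 < ρ) (h : ω < |y|) (h' : |y| < 2 * Real.pi - ω) : polar ρ y ∈ resolventSet A := by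
  by_contra hn
  exact polar_notMem_closedSector hρ hA.nonneg h h' (hA.spectrum_subset hn)

theorem IsAlmostSectorial.exists_bound (hA : IsAlmostSectorial γ ω A) {μ : ℝ} (hμ : ω < μ)
    (hμ' : μ ≤ Real.pi) : ∃ C : ℝ, 0 < C ∧ ∀ ρ y : ℝ, 0 < ρ → μ ≤ |y| →
      |y| ≤ 2 * Real.pi - μ → ‖resolvent A (polar ρ y)‖ ≤ C * ρ ^ γ := by
  -- The assumed bound holds only off a closed sector; a smaller aperture makes it cover the
  -- boundary rays `|y| = μ`, and also allows `μ = π`.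
  obtain ⟨C, hC, hb⟩ := hA.bound ((ω + μ) / 2) (by linarith) (by linarith)
  refine ⟨C, hC, fun ρ y hρ h1 h2 => ?_⟩
  have := hb (polar ρ y) (polar_notMem_closedSector hρ (by linarith [hA.nonneg])
    (by linarith) (by linarith))
  rwa [norm_polar hρ.le] at this

theorem IsAlmostSectorial.neg_one_mem (hA : IsAlmostSectorial γ ω A) :
    -1 ∈ resolventSet A := by
  rw [← polar_one_pi]
  have := hA.lt_pi
  have := Real.pi_pos
  refine hA.polar_mem_resolventSet one_pos ?_ ?_ <;> rw [abs_of_pos Real.pi_pos] <;> linarith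

/-- `(1 + A)⁻¹`. -/
def invOneAdd (A : X →ₗ.[ℂ] X) : X →L[ℂ] X := -resolvent A (-1)

theorem IsAlmostSectorial.invOneAdd_injective (hA : IsAlmostSectorial γ ω A) :
    Function.Injective (invOneAdd A) := by
  intro x y h
  exact resolvent_injective hA.neg_one_mem (neg_injective h)

theorem IsAlmostSectorial.invOneAdd_pow_injective (hA : IsAlmostSectorial γ ω A) (n : ℕ) :
    Function.Injective (invOneAdd A ^ n) := by
  induction n with
  | zero => exact fun x y h => h
  | succ n ih =>
    intro x y h
    rw [pow_succ] at h
    exact hA.invOneAdd_injective (ih h)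

variable [CompleteSpace X]

theorem mem_resolventSet_of_norm_lt {z w : ℂ} (hz : z ∈ resolventSet A)
    (h : ‖w - z‖ * ‖resolvent A z‖ < 1) : w ∈ resolventSet A := by
  refine ⟨_, isResolventAt_of_isUnit (isResolventAt_resolvent hz) ?_⟩
  have := isUnit_one_sub_of_norm_lt_one (x := -((w - z) • resolvent A z))
    (by rwa [norm_neg, norm_smul])
  rwa [sub_neg_eq_add] at this

theorem differentiableAt_resolvent {z : ℂ} (hz : z ∈ resolventSet A) :
    DifferentiableAt ℂ (resolvent A) z := by
  have hR := isResolventAt_resolvent hz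
  have hc : DifferentiableAt ℂ (fun w : ℂ => 1 + (w - z) • resolvent A z) z := by fun_prop
  have h1 : 1 + (z - z) • resolvent A z = 1 := by rw [sub_self, zero_smul, add_zero]
  have hu : {T : X →L[ℂ] X | IsUnit T} ∈ 𝓝 (1 + (z - z) • resolvent A z) := by
    rw [h1]
    exact Units.isOpen.mem_nhds isUnit_one
  have hinv : DifferentiableAt ℂ
      (fun w : ℂ => resolvent A z * Ring.inverse (1 + (w - z) • resolvent A z)) z := by
    refine (differentiableAt_const _).mul (DifferentiableAt.comp (g := Ring.inverse) z ?_ hc)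
    refine differentiableAt_inverse ?_
    rw [h1]; exact isUnit_one
  refine hinv.congr_of_eventuallyEq ?_
  filter_upwards [hc.continuousAt hu] with w hw
  exact (isResolventAt_of_isUnit hR hw).eq_resolvent

/-- An almost sectorial operator with negative exponent is invertible. -/
theorem IsAlmostSectorial.zero_mem (hA : IsAlmostSectorial γ ω A) :
    0 ∈ resolventSet A := by
  obtain ⟨C, hC, hb⟩ := hA.exists_bound hA.lt_pi le_rfl
  have hpi : |Real.pi| = Real.pi := abs_of_pos Real.pi_pos
  -- At the point `-ρ` the distance to `0` times the resolvent norm is at most `C ρ^(1+γ)`. As `γ >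
  -- -1` this falls below `1`, so the Neumann disc about `-ρ` contains `0`.
  have hlim : Tendsto (fun ρ : ℝ => C * ρ ^ (1 + γ)) (𝓝[>] 0) (𝓝 0) := by
    have h1 : 0 < 1 + γ := by linarith [hA.neg_one_lt]
    have := ((Real.continuousAt_rpow_const 0 (1 + γ) (Or.inr h1.le)).tendsto.const_mul C).mono_left
      (nhdsWithin_le_nhds (s := Ioi 0))
    simpa [Real.zero_rpow h1.ne'] using this
  obtain ⟨ρ, h1, hρ⟩ := ((hlim.eventually_lt_const one_pos).and self_mem_nhdsWithin).exists
  have hρ : 0 < ρ := hρ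
  refine mem_resolventSet_of_norm_lt (z := polar ρ Real.pi)
    (hA.polar_mem_resolventSet hρ (by rw [hpi]; exact hA.lt_pi)
      (by rw [hpi]; linarith [hA.lt_pi])) ?_
  rw [zero_sub, norm_neg, norm_polar hρ.le]
  refine lt_of_le_of_lt ?_ h1
  calc ρ * ‖resolvent A (polar ρ Real.pi)‖ ≤ ρ * (C * ρ ^ γ) := by
        gcongr; exact hb ρ _ hρ hpi.ge (by rw [hpi]; linarith)
    _ = C * ρ ^ (1 + γ) := by rw [Real.rpow_add hρ, Real.rpow_one]; ring

theorem IsAlmostSectorial.invOneAdd_eq (hA : IsAlmostSectorial γ ω A) :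
    invOneAdd A = (-1 + invOneAdd A) * resolvent A 0 := by
  have := smul_resolvent_mul_resolvent hA.neg_one_mem hA.zero_mem
  rw [zero_sub, neg_neg, one_smul] at this
  rw [invOneAdd, add_mul, neg_mul, neg_mul, this, one_mul]; abel

theorem IsAlmostSectorial.resolvent_zero_eq (hA : IsAlmostSectorial γ ω A) :
    resolvent A 0 = (-1 + resolvent A 0) * invOneAdd A := by
  have := smul_resolvent_mul_resolvent hA.zero_mem hA.neg_one_mem
  rw [sub_zero, neg_one_smul, neg_eq_iff_eq_neg] at this
  rw [invOneAdd, add_mul, mul_neg, mul_neg, this]; simp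

/-- Convergence after `A⁻¹` and after `(1 + A)⁻¹` are the same. -/
theorem IsAlmostSectorial.tendsto_resolvent_zero_iff (hA : IsAlmostSectorial γ ω A) {ι : Type*}
    {l : Filter ι} {u : ι → X} {x : X} :
    Tendsto (fun i => resolvent A 0 (u i)) l (𝓝 (resolvent A 0 x)) ↔
      Tendsto (fun i => invOneAdd A (u i)) l (𝓝 (invOneAdd A x)) := by
  constructor <;> intro h
  · have h2 := ((-1 + invOneAdd A).continuous.tendsto _).comp h
    have h3 : ∀ y, (-1 + invOneAdd A) (resolvent A 0 y) = invOneAdd A y := fun y =>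
      (congrArg (fun L : X →L[ℂ] X => L y) hA.invOneAdd_eq).symm
    simpa only [Function.comp_def, h3] using h2
  · have h2 := ((-1 + resolvent A 0).continuous.tendsto _).comp h
    have h3 : ∀ y, (-1 + resolvent A 0) (invOneAdd A y) = resolvent A 0 y := fun y =>
      (congrArg (fun L : X →L[ℂ] X => L y) hA.resolvent_zero_eq).symm
    simpa only [Function.comp_def, h3] using h2

end Resolvent

/-! ### Scalar Cauchy formulas on a sector -/

section Scalar

/-- The open sector `{z ≠ 0 : |arg z| < μ}`, for `μ ≤ π`. -/
def openSector (μ : ℝ) : Set ℂ := {z | z ∈ Complex.slitPlane ∧ |z.arg| < μ}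

theorem isOpen_openSector (μ : ℝ) : IsOpen (openSector μ) := by
  have h : ContinuousOn (fun z : ℂ => |z.arg|) Complex.slitPlane := fun z hz =>
    ((Complex.continuousAt_arg hz).abs).continuousWithinAt
  exact h.isOpen_inter_preimage Complex.isOpen_slitPlane isOpen_Iio

theorem polar_mem_openSector {μ ρ y : ℝ} (hμ : μ ≤ Real.pi) (hρ : 0 < ρ) (hy : |y| < μ) :
    polar ρ y ∈ openSector μ :=
  ⟨polar_mem_slitPlane hρ (hy.trans_le hμ), by rwa [arg_polar hρ (hy.trans_le hμ)]⟩

theorem exists_polar_of_mem_openSector {μ : ℝ} {z : ℂ} (hz : z ∈ openSector μ) :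
    ∃ ρ y : ℝ, 0 < ρ ∧ |y| < μ ∧ z = polar ρ y :=
  ⟨‖z‖, z.arg, norm_pos_iff.2 (Complex.slitPlane_ne_zero hz.1), hz.2, (polar_norm_arg z).symm⟩

/-- Holomorphic functions on a sector which are `O(1 / (1 + |z|))`. -/
structure IsDecaying (μ : ℝ) (f : ℂ → ℂ) : Prop where
  differentiableAt : ∀ z ∈ openSector μ, DifferentiableAt ℂ f z
  bound : ∃ C : ℝ, 0 ≤ C ∧ ∀ z ∈ openSector μ, ‖f z‖ ≤ C / (1 + ‖z‖)

theorem one_div_add_le {ρ s : ℝ} (hρ : 0 < ρ) (hs : 0 < s) :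
    1 / (ρ + s) ≤ (1 + 1 / s) / (1 + ρ) := by
  rw [div_le_div_iff₀ (by positivity) (by positivity)]
  have : (1 + 1 / s) * (ρ + s) = ρ + s + ρ / s + 1 := by field_simp; ring
  rw [this]
  have : 0 < ρ / s := by positivity
  linarith

/-- For fixed `s > 0` the denominator contributes a second factor `1/(1 + ρ)`, and quadratic decay
is dominated by the weight. -/
theorem norm_div_le_weight {ρ s c C β : ℝ} {x d : ℂ} (h1 : -1 < β) (h0 : β < 0) (hρ : 0 < ρ)
    (hs : 0 < s) (hc : 0 < c) (hx : ‖x‖ ≤ C / (1 + ρ)) (hd : c * (ρ + s) ≤ ‖d‖) :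
    ‖x / d‖ ≤ C * (1 + 1 / s) / c * weight β ρ := by
  have hC : 0 ≤ C := by
    have := (norm_nonneg x).trans hx
    by_contra hn
    exact absurd this (not_le.2 (div_neg_of_neg_of_pos (not_le.1 hn) (by positivity)))
  have hd0 : 0 < c * (ρ + s) := by positivity
  rw [norm_div]
  calc ‖x‖ / ‖d‖ ≤ (C / (1 + ρ)) / (c * (ρ + s)) := by gcongr
    _ = C / c / (1 + ρ) * (1 / (ρ + s)) := by field_simp
    _ ≤ C / c / (1 + ρ) * ((1 + 1 / s) / (1 + ρ)) := by
        exact mul_le_mul_of_nonneg_left (one_div_add_le hρ hs) (by positivity)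
    _ = C * (1 + 1 / s) / c * (1 / (1 + ρ) / (1 + ρ)) := by field_simp
    _ ≤ _ := by
        gcongr; exact one_div_sq_le_weight h1 h0 hρ

theorem one_add_mul_mem_slitPlane {u : ℂ} (hu : u ∈ Complex.slitPlane) {ρ : ℝ} (hρ : 0 ≤ ρ) :
    1 + ρ * u ∈ Complex.slitPlane := by
  rcases hρ.eq_or_lt with rfl | hρ
  · simp
  rw [Complex.mem_slitPlane_iff] at hu ⊢
  simp only [Complex.add_re, Complex.one_re, Complex.re_ofReal_mul, Complex.add_im,
    Complex.one_im, Complex.im_ofReal_mul, zero_add]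
  rcases hu with h | h
  · exact Or.inl (by positivity)
  · exact Or.inr (mul_ne_zero hρ.ne' h)

/-- The function `log(1 + ρu) - log(1 + ρe)` is a primitive, since `1 + ρu` never leaves the slit
plane. At infinity the two `log ρ` terms cancel. -/
theorem integral_div_one_add_sub {u e : ℂ} (hu : u ∈ Complex.slitPlane)
    (he : e ∈ Complex.slitPlane)
    (hi : IntegrableOn (fun ρ : ℝ => u / (1 + ρ * u) - e / (1 + ρ * e)) (Ioi 0)) :
    ∫ ρ in Ioi (0 : ℝ), (u / (1 + ρ * u) - e / (1 + ρ * e)) = Complex.log u - Complex.log e := by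
  have hd : ∀ v ∈ Complex.slitPlane, ∀ ρ ∈ Ici (0 : ℝ),
      HasDerivAt (fun ρ : ℝ => Complex.log (1 + ρ * v)) (v / (1 + ρ * v)) ρ := by
    intro v hv ρ hρ
    have h1 : HasDerivAt (fun ρ : ℝ => 1 + (ρ : ℂ) * v) v ρ := by
      simpa using ((Complex.ofRealCLM.hasDerivAt (x := ρ)).mul_const v).const_add 1
    exact h1.clog_real (one_add_mul_mem_slitPlane hv hρ)
  have ht : Tendsto (fun ρ : ℝ => Complex.log (1 + ρ * u) - Complex.log (1 + ρ * e)) atTop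
      (𝓝 (Complex.log u - Complex.log e)) := by
    have h1 : ∀ v ∈ Complex.slitPlane, Tendsto (fun ρ : ℝ => Complex.log ((ρ⁻¹ : ℝ) + v)) atTop
        (𝓝 (Complex.log v)) := by
      intro v hv
      have h2 : Tendsto (fun ρ : ℝ => ((ρ⁻¹ : ℝ) : ℂ) + v) atTop (𝓝 (((0 : ℝ) : ℂ) + v)) :=
        ((Complex.continuous_ofReal.tendsto 0).comp tendsto_inv_atTop_zero).add_const v
      rw [Complex.ofReal_zero, zero_add] at h2
      exact h2.clog hv
    refine ((h1 u hu).sub (h1 e he)).congr' ?_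
    filter_upwards [eventually_gt_atTop 0] with ρ hρ
    have h3 : ∀ v ∈ Complex.slitPlane, Complex.log (1 + ρ * v) =
        Real.log ρ + Complex.log ((ρ⁻¹ : ℝ) + v) := by
      intro v hv
      have h4 : (1 + ρ * v : ℂ) = ρ * ((ρ⁻¹ : ℝ) + v) := by
        push_cast
        rw [mul_add, mul_inv_cancel₀ (Complex.ofReal_ne_zero.2 hρ.ne')]
      rw [h4, Complex.log_ofReal_mul hρ]
      intro h5
      rw [h5, mul_zero] at h4
      exact Complex.slitPlane_ne_zero (one_add_mul_mem_slitPlane hv hρ.le) h4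
    rw [h3 u hu, h3 e he]; ring
  have := integral_Ioi_of_hasDerivAt_of_tendsto' (a := (0 : ℝ))
    (fun ρ hρ => (hd u hu ρ hρ).sub (hd e he ρ hρ)) hi ht
  simpa using this

/-- The kernel `1/(z-w) - 1/(1+z)`. -/
def cauchyKernel (w z : ℂ) : ℂ := 1 / (z - w) - 1 / (1 + z)

theorem one_add_polar_ne_zero {ρ y : ℝ} (hρ : 0 < ρ) (hy : |y| < Real.pi) :
    1 + polar ρ y ≠ 0 := by
  obtain ⟨c, hc, h⟩ := exists_mul_le_norm_one_add_polar (abs_nonneg y) hy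
  have := h ρ y hρ.le le_rfl
  rw [← norm_pos_iff]
  exact lt_of_lt_of_le (by positivity) this

theorem polar_sub_polar_ne_zero {ρ s a b : ℝ} (hρ : 0 < ρ) (ha : |a| < Real.pi)
    (hb : |b| < Real.pi) (hs : 0 < s) (hab : a ≠ b) : polar ρ a - polar s b ≠ 0 := by
  intro h
  have := congrArg Complex.arg (sub_eq_zero.1 h)
  rw [arg_polar hρ ha, arg_polar hs hb] at this
  exact hab this

theorem exists_mul_le_norm_polar_sub' {a b : ℝ} (ha : |a| < Real.pi) (hb : |b| < Real.pi)
    (hab : a ≠ b) : ∃ c : ℝ, 0 < c ∧ ∀ ρ s : ℝ, 0 ≤ ρ → 0 ≤ s →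
      c * (ρ + s) ≤ ‖polar ρ a - polar s b‖ := by
  have h1 : |a - b| < 2 * Real.pi := (abs_sub a b).trans_lt (by linarith)
  have h2 : 0 < |a - b| := abs_pos.2 (sub_ne_zero.2 hab)
  obtain ⟨c, hc, h⟩ := exists_mul_le_norm_polar_sub
    (δ := min (min |a - b| (2 * Real.pi - |a - b|)) Real.pi)
    (lt_min (lt_min h2 (by linarith)) Real.pi_pos) (min_le_right _ _)
  refine ⟨c, hc, fun ρ s hρ hs => h ρ s a b hρ hs ((min_le_left _ _).trans (min_le_left _ _)) ?_⟩
  have := (min_le_left (min |a - b| (2 * Real.pi - |a - b|)) Real.pi).trans (min_le_right _ _)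
  linarith

/-- Alone, `1/(z - w)` decays too slowly. Subtracting `1/(1 + z)`, whose pole lies outside the
sector, leaves `(1 + w)/((1 + z)(z - w))`, which decays quadratically. -/
theorem rayIntegrable_cauchyKernel {a b s : ℝ} (hs : 0 < s) (ha : |a| < Real.pi)
    (hb : |b| < Real.pi) (hab : a ≠ b) : RayIntegrable a (cauchyKernel (polar s b)) := by
  obtain ⟨c, hc, h⟩ := exists_mul_le_norm_polar_sub' ha hb hab
  obtain ⟨c', hc', h'⟩ := exists_mul_le_norm_one_add_polar (abs_nonneg a) ha
  refine rayIntegrable_of_bound (β := -1 / 2)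
    (C := ‖1 + polar s b‖ / c' * (1 + 1 / s) / c) (by norm_num) (by norm_num) ?_ ?_
  · intro ρ hρ
    have h1 := one_add_polar_ne_zero hρ ha
    have h2 := polar_sub_polar_ne_zero hρ ha hb hs hab
    unfold cauchyKernel
    fun_prop (disch := assumption)
  · intro ρ hρ
    have h1 := one_add_polar_ne_zero hρ ha
    have h2 := polar_sub_polar_ne_zero hρ ha hb hs hab
    have h3 : cauchyKernel (polar s b) (polar ρ a) =
        ((1 + polar s b) / (1 + polar ρ a)) / (polar ρ a - polar s b) := by
      rw [cauchyKernel]; field_simp; ring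
    rw [h3]
    refine norm_div_le_weight (by norm_num) (by norm_num) hρ hs hc ?_ (h ρ s hρ.le hs.le)
    rw [norm_div, div_div]
    gcongr
    exact h' ρ a hρ.le le_rfl

/-- Each ray contributes `log(-e^{ia}/w) - log(e^{ia})`. The principal argument of `-e^{ia}/w` is `a
- b + π` on the lower ray and `a - b - π` on the upper one, so the difference of the two
contributions is `2πi`. -/
theorem contour_cauchyKernel {θ b s : ℝ} (hs : 0 < s) (hb : |b| < θ) (hθ : θ < Real.pi) :
    contour θ (cauchyKernel (polar s b)) = 1 := by
  have hθ0 : 0 < θ := (abs_nonneg b).trans_lt hb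
  have hb' := abs_lt.1 hb
  have key : ∀ a d : ℝ, |a| = θ → |d| < Real.pi → polar s⁻¹ d * polar s b = - polar 1 a →
      ray a (cauchyKernel (polar s b)) = Complex.log (polar s⁻¹ d) - Complex.log (polar 1 a) := by
    intro a d ha hd hmul
    have ha' : |a| < Real.pi := by rwa [ha]
    have hab : a ≠ b := by rintro rfl; linarith
    have hmem := polar_mem_slitPlane (inv_pos.2 hs) hd
    have hmem1 := polar_mem_slitPlane one_pos ha'
    have hw := polar_ne_zero hs b
    have hfun : ∀ ρ ∈ Ioi (0 : ℝ), Complex.exp (a * Complex.I) •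
        cauchyKernel (polar s b) (polar ρ a) =
        polar s⁻¹ d / (1 + ρ * polar s⁻¹ d) - polar 1 a / (1 + ρ * polar 1 a) := by
      intro ρ hρ
      have hρ : 0 < ρ := hρ
      have h1 := one_add_polar_ne_zero hρ ha'
      have h2 := polar_sub_polar_ne_zero hρ ha' (hb.trans hθ) hs hab
      have he : Complex.exp (a * Complex.I) = polar 1 a := by simp [polar]
      have hp : polar ρ a = ρ * polar 1 a := by simp [polar]
      have hd' : polar s⁻¹ d = - polar 1 a / polar s b := by
        rw [eq_div_iff hw, hmul]
      have h3 : polar s b - ρ * polar 1 a ≠ 0 := by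
        rw [← neg_ne_zero, neg_sub, ← hp]; exact h2
      rw [hp] at h1 h2
      rw [cauchyKernel, he, hp, hd', smul_eq_mul]
      have h4 : 1 + ρ * (-polar 1 a / polar s b) = (polar s b - ρ * polar 1 a) / polar s b := by
        field_simp; ring
      rw [h4, div_div_div_cancel_right₀ hw, mul_sub, ← neg_sub (ρ * polar 1 a), neg_div_neg_eq]
      ring
    rw [ray, setIntegral_congr_fun measurableSet_Ioi hfun]
    refine integral_div_one_add_sub hmem hmem1 ?_
    exact IntegrableOn.congr_fun (f := fun ρ => Complex.exp (a * Complex.I) •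
      cauchyKernel (polar s b) (polar ρ a))
      ((rayIntegrable_cauchyKernel hs ha' (hb.trans hθ) hab).smul (Complex.exp (a * Complex.I)))
      hfun measurableSet_Ioi
  have hmul : ∀ a d : ℝ, Complex.exp ((d + b - a : ℝ) * Complex.I) = -1 →
      polar s⁻¹ d * polar s b = - polar 1 a := by
    intro a d h
    have h1 : (s : ℂ) ≠ 0 := Complex.ofReal_ne_zero.2 hs.ne'
    have h2 : Complex.exp (d * Complex.I) * Complex.exp (b * Complex.I) =
        - Complex.exp (a * Complex.I) := by
      rw [← neg_one_mul, ← h, ← Complex.exp_add, ← Complex.exp_add]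
      congr 1; push_cast; ring
    rw [polar, polar, polar, Complex.ofReal_inv, mul_mul_mul_comm, h2, inv_mul_cancel₀ h1]
    simp
  have hd1 : |(-θ) - b + Real.pi| < Real.pi := abs_lt.2 ⟨by linarith, by linarith⟩
  have hd2 : |θ - b - Real.pi| < Real.pi := abs_lt.2 ⟨by linarith, by linarith⟩
  have hθ1 : |-θ| = θ := by rw [abs_neg, abs_of_pos hθ0]
  have hθ2 : |θ| = θ := abs_of_pos hθ0
  rw [contour, key (-θ) (-θ - b + Real.pi) hθ1 hd1 (hmul _ _ ?_),
    key θ (θ - b - Real.pi) hθ2 hd2 (hmul _ _ ?_), log_polar (inv_pos.2 hs) hd1,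
    log_polar (inv_pos.2 hs) hd2, log_polar one_pos (hθ1.trans_lt hθ),
    log_polar one_pos (hθ2.trans_lt hθ)]
  · have := Complex.two_pi_I_ne_zero
    rw [smul_eq_mul, inv_mul_eq_div, div_eq_one_iff_eq this]
    push_cast; ring
  · rw [← Complex.exp_neg_pi_mul_I]
    congr 1; push_cast; ring
  · rw [← Complex.exp_pi_mul_I]
    congr 1; push_cast; ring

theorem IsDecaying.bound_polar {μ : ℝ} {f : ℂ → ℂ} (hf : IsDecaying μ f) (hμ : μ ≤ Real.pi) :
    ∃ C : ℝ, 0 ≤ C ∧ ∀ ρ y : ℝ, 0 < ρ → |y| < μ → ‖f (polar ρ y)‖ ≤ C / (1 + ρ) := by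
  obtain ⟨C, hC, h⟩ := hf.bound
  refine ⟨C, hC, fun ρ y hρ hy => ?_⟩
  have := h _ (polar_mem_openSector hμ hρ hy)
  rwa [norm_polar hρ.le] at this

/-- The lower ray can be turned onto the upper one through the sector. -/
theorem contour_eq_zero {E : Type*} [NormedAddCommGroup E] [NormedSpace ℂ E] [CompleteSpace E]
    {θ C β r R : ℝ} (hθ : 0 ≤ θ) {F : ℂ → E} (h1 : -1 < β) (h0 : β < 0) (hr : 0 < r)
    (hd : ∀ ρ y, 0 < ρ → |y| ≤ θ → DifferentiableAt ℂ F (polar ρ y))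
    (hb : ∀ ρ y, 0 < ρ → |y| ≤ θ → ρ < r ∨ R < ρ → ‖F (polar ρ y)‖ ≤ C * weight β ρ)
    (hi : ContourIntegrable θ F) : contour θ F = 0 := by
  have := ray_eq_ray (a := -θ) (b := θ) (by linarith) (F := F) h1 h0 hr
    (fun y hy ρ hρ => hd ρ y hρ (abs_le.2 hy)) (fun y hy ρ hρ => hb ρ y hρ (abs_le.2 hy))
    (hi _ (by rw [abs_neg, abs_of_nonneg hθ])) (hi _ (abs_of_nonneg hθ))
  rw [contour, this, sub_self, smul_zero]

/-- Cauchy's formula for a point outside the sector. -/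
theorem contour_div_sub_eq_zero {μ θ s b : ℝ} {f : ℂ → ℂ} (hf : IsDecaying μ f)
    (hθ : 0 ≤ θ) (hθμ : θ < μ) (hμ : μ ≤ Real.pi) (hs : 0 < s) (hb : θ < |b|)
    (hb' : |b| < Real.pi) : contour θ (fun z => f z / (polar s b - z)) = 0 ∧
      ContourIntegrable θ (fun z => f z / (polar s b - z)) := by
  obtain ⟨C, hC, hbd⟩ := hf.bound_polar hμ
  -- The angular gap between the outside point and the sector, measured on its own side and across
  -- the negative axis.
  obtain ⟨c, hc, hcb⟩ := exists_mul_le_norm_polar_sub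
    (δ := min (|b| - θ) (2 * Real.pi - (|b| + θ)))
    (lt_min (by linarith) (by linarith))
    (by
      rcases le_total (|b| - θ) Real.pi with h | h
      · exact (min_le_left _ _).trans h
      · exact (min_le_right _ _).trans (by linarith))
  have hne : ∀ ρ y, 0 < ρ → |y| ≤ θ → polar s b - polar ρ y ≠ 0 := fun ρ y hρ hy =>
    polar_sub_polar_ne_zero hs hb' (by linarith) hρ (by rintro rfl; linarith)
  have hD : ∀ ρ y, 0 < ρ → |y| ≤ θ →
      DifferentiableAt ℂ (fun z => f z / (polar s b - z)) (polar ρ y) := by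
    intro ρ y hρ hy
    have h1 := hf.differentiableAt _ (polar_mem_openSector hμ hρ (hy.trans_lt hθμ))
    exact h1.div (by fun_prop) (hne ρ y hρ hy)
  have hB : ∀ ρ y, 0 < ρ → |y| ≤ θ → ‖f (polar ρ y) / (polar s b - polar ρ y)‖ ≤
      C * (1 + 1 / s) / c * weight (-1 / 2) ρ := by
    intro ρ y hρ hy
    refine norm_div_le_weight (by norm_num) (by norm_num) hρ hs hc
      (hbd ρ y hρ (hy.trans_lt hθμ)) ?_
    rw [add_comm]
    refine hcb s ρ b y hs.le hρ.le ?_ ?_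
    · refine (min_le_left _ _).trans ?_
      have := abs_sub_abs_le_abs_sub b y
      linarith
    · have h1 := abs_sub b y
      have h2 := min_le_right (|b| - θ) (2 * Real.pi - (|b| + θ))
      linarith
  have hi : ContourIntegrable θ (fun z => f z / (polar s b - z)) := fun a ha =>
    rayIntegrable_of_bound (by norm_num) (by norm_num)
      (fun ρ hρ => (hD ρ a hρ ha.le).continuousAt) (fun ρ hρ => hB ρ a hρ ha.le)
  exact ⟨contour_eq_zero hθ (by norm_num) (by norm_num) (r := 1) (R := 1) one_pos hD
    (fun ρ y hρ hy _ => hB ρ y hρ hy) hi, hi⟩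

/-- Cauchy's formula for a point inside the sector. -/
theorem contour_div_sub {μ θ s b : ℝ} {f : ℂ → ℂ} (hf : IsDecaying μ f)
    (hθμ : θ < μ) (hμ : μ ≤ Real.pi) (hs : 0 < s) (hb : |b| < θ) :
    contour θ (fun z => f z / (z - polar s b)) = f (polar s b) ∧
      ContourIntegrable θ (fun z => f z / (z - polar s b)) := by
  have hθ : 0 < θ := (abs_nonneg b).trans_lt hb
  have hθπ : θ < Real.pi := by linarith
  set w := polar s b with hw
  have hwn : ‖w‖ = s := norm_polar hs.le b
  obtain ⟨C, hC, hbd⟩ := hf.bound_polar hμ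
  obtain ⟨c', hc', hcb'⟩ := exists_mul_le_norm_one_add_polar hθ.le hθπ
  have hwmem : w ∈ openSector μ := polar_mem_openSector hμ hs (hb.trans hθμ)
  have hone : ∀ ρ y, 0 < ρ → |y| ≤ θ → 1 + polar ρ y ≠ 0 := fun ρ y hρ hy =>
    one_add_polar_ne_zero hρ (hy.trans_lt hθπ)
  -- Off `w` this is `f z / (z - w) - f w * cauchyKernel w z`: the pole is removed and the decay
  -- stays integrable. Hence `G` integrates to `0`, and the kernel supplies the value `f w`.
  set G : ℂ → ℂ := fun z => dslope f w z + f w / (1 + z) with hG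
  have hGeq : ∀ z, z ≠ w → G z = f z / (z - w) - f w * cauchyKernel w z := by
    intro z hz
    have h2 : z - w ≠ 0 := sub_ne_zero.2 hz
    simp only [hG, dslope_of_ne f hz, slope_def_field, cauchyKernel]
    ring
  have hGeq' : ∀ ρ y, 0 < ρ → |y| ≤ θ → polar ρ y ≠ w → G (polar ρ y) =
      f (polar ρ y) / (polar ρ y - w) - f w * (1 + w) / (1 + polar ρ y) / (polar ρ y - w) := by
    intro ρ y hρ hy h
    have h1 := hone ρ y hρ hy
    have h2 : polar ρ y - w ≠ 0 := sub_ne_zero.2 h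
    rw [hGeq _ h, cauchyKernel]
    field_simp
    ring
  have hB : ∀ (c ρ y : ℝ), 0 < c → 0 < ρ → |y| ≤ θ → c * (ρ + s) ≤ ‖polar ρ y - w‖ →
      ‖G (polar ρ y)‖ ≤ (C * (1 + 1 / s) / c + ‖f w * (1 + w)‖ / c' * (1 + 1 / s) / c) *
        weight (-1 / 2) ρ ∧ ‖f (polar ρ y) / (polar ρ y - w)‖ ≤
          C * (1 + 1 / s) / c * weight (-1 / 2) ρ := by
    intro c ρ y hc hρ hy h
    have hne : polar ρ y ≠ w := by
      rw [← sub_ne_zero, ← norm_pos_iff]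
      exact lt_of_lt_of_le (by positivity) h
    have hf1 : ‖f (polar ρ y) / (polar ρ y - w)‖ ≤
          C * (1 + 1 / s) / c * weight (-1 / 2) ρ :=
      norm_div_le_weight (by norm_num) (by norm_num) hρ hs hc (hbd ρ y hρ (hy.trans_lt hθμ)) h
    refine ⟨?_, hf1⟩
    rw [hGeq' ρ y hρ hy hne, add_mul]
    refine (norm_sub_le _ _).trans (add_le_add hf1 ?_)
    refine norm_div_le_weight (by norm_num) (by norm_num) hρ hs hc ?_ h
    rw [norm_div, div_div]
    gcongr
    exact hcb' ρ y hρ.le hy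
  have hD : ∀ ρ y, 0 < ρ → |y| ≤ θ → DifferentiableAt ℂ G (polar ρ y) := by
    intro ρ y hρ hy
    have h1 : DifferentiableOn ℂ (dslope f w) (openSector μ) :=
      (Complex.differentiableOn_dslope ((isOpen_openSector μ).mem_nhds hwmem)).2
        fun z hz => (hf.differentiableAt z hz).differentiableWithinAt
    have h2 := h1.differentiableAt ((isOpen_openSector μ).mem_nhds
      (polar_mem_openSector hμ hρ (hy.trans_lt hθμ)))
    have h3 := hone ρ y hρ hy
    exact h2.add ((differentiableAt_const _).div (by fun_prop) h3)
  have hsep : ∀ a, |a| = θ → ∃ c : ℝ, 0 < c ∧ ∀ ρ, 0 < ρ → c * (ρ + s) ≤ ‖polar ρ a - w‖ := by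
    intro a ha
    obtain ⟨c, hc, h⟩ := exists_mul_le_norm_polar_sub' (a := a) (b := b) (by rwa [ha])
      (hb.trans hθπ) (by rintro rfl; linarith)
    exact ⟨c, hc, fun ρ hρ => h ρ s hρ.le hs.le⟩
  have hiG : ContourIntegrable θ G := by
    intro a ha
    obtain ⟨c, hc, h⟩ := hsep a ha
    exact rayIntegrable_of_bound (by norm_num) (by norm_num)
      (fun ρ hρ => (hD ρ a hρ ha.le).continuousAt)
      (fun ρ hρ => (hB c ρ a hc hρ ha.le (h ρ hρ)).1)
  have hne : ∀ a, |a| = θ → ∀ ρ, 0 < ρ → polar ρ a ≠ w := by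
    intro a ha ρ hρ h
    have := congrArg Complex.arg h
    rw [hw, arg_polar hρ (by rwa [ha]), arg_polar hs (hb.trans hθπ)] at this
    rw [this] at ha; linarith
  have hiK : ContourIntegrable θ (fun z => f w * cauchyKernel w z) := fun a ha =>
    (rayIntegrable_cauchyKernel hs (by rwa [ha]) (hb.trans hθπ)
      (by rintro rfl; linarith)).const_mul (f w)
  have hi : ContourIntegrable θ (fun z => f z / (z - w)) := by
    intro a ha
    obtain ⟨c, hc, h⟩ := hsep a ha
    refine rayIntegrable_of_bound (by norm_num) (by norm_num) (fun ρ hρ => ?_)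
      (fun ρ hρ => (hB c ρ a hc hρ ha.le (h ρ hρ)).2)
    exact (hf.differentiableAt _ (polar_mem_openSector hμ hρ (by rwa [ha]))).continuousAt.div
      (by fun_prop) (sub_ne_zero.2 (hne a ha ρ hρ))
  have hzero : contour θ G = 0 := by
    -- Outside the annulus `s/2 ≤ ρ ≤ 2s` one has `|ρ - s| ≥ (ρ + s)/3` whatever the angle; this is
    -- the source of the constant `1/3`.
    refine contour_eq_zero hθ.le (β := -1 / 2) (by norm_num) (by norm_num)
      (r := s / 2) (R := 2 * s) (by positivity) hD ?_ hiG
      (C := (C * (1 + 1 / s) / (1 / 3) + ‖f w * (1 + w)‖ / c' * (1 + 1 / s) / (1 / 3)))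
    intro ρ y hρ hy hrange
    refine (hB (1 / 3) ρ y (by norm_num) hρ hy ?_).1
    have h1 := abs_norm_sub_norm_le (polar ρ y) w
    rw [norm_polar hρ.le, hwn] at h1
    refine le_trans ?_ h1
    rcases hrange with h | h
    · rw [abs_of_neg (by linarith)]; linarith
    · rw [abs_of_pos (by linarith)]; linarith
  have hsum : contour θ (fun z => f z / (z - w)) =
      contour θ (fun z => G z + f w * cauchyKernel w z) :=
    contour_congr hθ.le fun a ha ρ hρ => by rw [hGeq _ (hne a ha ρ hρ), sub_add_cancel]
  have hK := map_contour (ContinuousLinearMap.mul ℂ ℂ (f w)) hθ.le (G := cauchyKernel w)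
    fun a ha => rayIntegrable_cauchyKernel hs (by rwa [ha]) (hb.trans hθπ)
      (by rintro rfl; linarith)
  rw [contour_cauchyKernel hs hb hθπ] at hK
  simp only [ContinuousLinearMap.mul_apply'] at hK
  refine ⟨?_, hi⟩
  rw [hsum, contour_add hθ.le hiG hiK, hzero, zero_add, ← hK, mul_one]

end Scalar

/-! ### The functional calculus and its multiplicativity -/

section Calculus

variable {X : Type*} [NormedAddCommGroup X] [NormedSpace ℂ X] {A : X →ₗ.[ℂ] X} {γ ω : ℝ}
variable {μ : ℝ} {f g : ℂ → ℂ}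

theorem IsDecaying.mul (hf : IsDecaying μ f) (hg : IsDecaying μ g) :
    IsDecaying μ (fun z => f z * g z) := by
  obtain ⟨C, hC, hb⟩ := hf.bound
  obtain ⟨D, hD, hb'⟩ := hg.bound
  refine ⟨fun z hz => (hf.differentiableAt z hz).mul (hg.differentiableAt z hz), C * D,
    mul_nonneg hC hD, fun z hz => ?_⟩
  rw [norm_mul]
  have h1 := hb z hz
  have h2 : ‖g z‖ ≤ D := (hb' z hz).trans (div_le_self hD (by linarith [norm_nonneg z]))
  calc ‖f z‖ * ‖g z‖ ≤ C / (1 + ‖z‖) * D := by gcongr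
    _ = _ := by ring

theorem isDecaying_one_add_inv (hμ0 : 0 ≤ μ) (hμ : μ < Real.pi) :
    IsDecaying μ (fun z => (1 + z)⁻¹) := by
  obtain ⟨c, hc, h⟩ := exists_mul_le_norm_one_add_polar hμ0 hμ
  constructor
  · intro z hz
    obtain ⟨ρ, y, hρ, hy, rfl⟩ := exists_polar_of_mem_openSector hz
    have := one_add_polar_ne_zero hρ (hy.trans hμ)
    fun_prop (disch := assumption)
  · refine ⟨c⁻¹, inv_nonneg.2 hc.le, fun z hz => ?_⟩
    obtain ⟨ρ, y, hρ, hy, rfl⟩ := exists_polar_of_mem_openSector hz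
    rw [norm_polar hρ.le, norm_inv, div_eq_mul_inv, ← mul_inv]
    exact inv_anti₀ (by positivity) (h ρ y hρ.le hy.le)

variable [CompleteSpace X]

theorem IsAlmostSectorial.exists_bound_smul (hA : IsAlmostSectorial γ ω A) (hf : IsDecaying μ f)
    (hμ : μ ≤ Real.pi) {θ : ℝ} (hθ : ω < θ) (hθμ : θ < μ) :
    ∃ C : ℝ, 0 ≤ C ∧ ∀ ρ y : ℝ, 0 < ρ → θ ≤ |y| → |y| < μ →
      DifferentiableAt ℂ (fun z => f z • resolvent A z) (polar ρ y) ∧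
      ‖f (polar ρ y) • resolvent A (polar ρ y)‖ ≤ C * weight γ ρ := by
  obtain ⟨C, hC, hb⟩ := hf.bound_polar hμ
  obtain ⟨D, hD, hR⟩ := hA.exists_bound hθ (hθμ.le.trans hμ)
  refine ⟨C * D, by positivity, fun ρ y hρ h1 h2 => ⟨?_, ?_⟩⟩
  · exact (hf.differentiableAt _ (polar_mem_openSector hμ hρ h2)).smul
      (differentiableAt_resolvent (hA.polar_mem_resolventSet hρ (by linarith) (by linarith)))
  · rw [norm_smul]
    calc _ ≤ C / (1 + ρ) * (D * ρ ^ γ) := by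
          gcongr
          · exact hb ρ y hρ h2
          · exact hR ρ y hρ h1 (by linarith)
      _ = _ := by rw [weight]; ring

theorem IsAlmostSectorial.contourIntegrable (hA : IsAlmostSectorial γ ω A) (hf : IsDecaying μ f)
    (hμ : μ ≤ Real.pi) {θ : ℝ} (hθ : ω < θ) (hθμ : θ < μ) :
    ContourIntegrable θ (fun z => f z • resolvent A z) := by
  obtain ⟨C, -, h⟩ := hA.exists_bound_smul hf hμ hθ hθμ
  intro a ha
  exact rayIntegrable_of_bound hA.neg_one_lt hA.lt_zero
    (fun ρ hρ => (h ρ a hρ ha.ge (by rwa [ha])).1.continuousAt)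
    (fun ρ hρ => (h ρ a hρ ha.ge (by rwa [ha])).2)

/-- The functional calculus does not depend on the angle. -/
theorem IsAlmostSectorial.funCalc_eq_funCalc (hA : IsAlmostSectorial γ ω A) (hf : IsDecaying μ f)
    (hμ : μ ≤ Real.pi) {θ θ' : ℝ} (hθ : ω < θ) (hθθ' : θ ≤ θ') (hθμ : θ' < μ) :
    funCalc A θ f = funCalc A θ' f := by
  have h0 := hA.nonneg
  obtain ⟨C, -, h⟩ := hA.exists_bound_smul hf hμ hθ (hθθ'.trans_lt hθμ)
  have hi := hA.contourIntegrable hf hμ hθ (hθθ'.trans_lt hθμ)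
  have hi' := hA.contourIntegrable hf hμ (hθ.trans_le hθθ') hθμ
  have n1 : |-θ| = θ := by rw [abs_neg, abs_of_nonneg (by linarith)]
  have p1 : |θ| = θ := abs_of_nonneg (by linarith)
  have n2 : |-θ'| = θ' := by rw [abs_neg, abs_of_nonneg (by linarith)]
  have p2 : |θ'| = θ' := abs_of_nonneg (by linarith)
  rw [funCalc_eq_contour, funCalc_eq_contour, contour, contour]
  congr 2
  · symm
    refine ray_eq_ray (C := C) (r := 1) (R := 1) (by linarith) hA.neg_one_lt hA.lt_zero one_pos
      (fun y hy ρ hρ => ?_) (fun y hy ρ hρ _ => ?_) (hi' _ n2) (hi _ n1)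
    all_goals
      have hy1 : |y| = -y := abs_of_nonpos (by linarith [hy.2])
      have := h ρ y hρ (by linarith [hy.2]) (by linarith [hy.1])
    · exact this.1
    · exact this.2
  · refine ray_eq_ray (C := C) (r := 1) (R := 1) (by linarith) hA.neg_one_lt hA.lt_zero one_pos
      (fun y hy ρ hρ => ?_) (fun y hy ρ hρ _ => ?_) (hi _ p1) (hi' _ p2)
    all_goals
      have hy1 : |y| = y := abs_of_nonneg (by linarith [hy.1])
      have := h ρ y hρ (by linarith [hy.1]) (by linarith [hy.2])
    · exact this.1
    · exact this.2

/-- The resolvent identity splits `R(z) R(w)` into two terms. The one with the constant operator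
`R(w)` carries the scalar integral of `f z / (w - z)`, which vanishes because `w` lies outside the
contour. -/
theorem IsAlmostSectorial.funCalc_mul_resolvent (hA : IsAlmostSectorial γ ω A)
    (hf : IsDecaying μ f) (hμ : μ ≤ Real.pi) {θ s b : ℝ} (hθ : ω < θ) (hθμ : θ < μ) (hs : 0 < s)
    (hb : θ < |b|) (hb' : |b| < Real.pi) :
    funCalc A θ f * resolvent A (polar s b) =
      contour θ (fun z => (f z / (polar s b - z)) • resolvent A z) := by
  have h0 : 0 ≤ θ := hA.nonneg.trans hθ.le
  obtain ⟨hz, hzi⟩ := contour_div_sub_eq_zero hf h0 hθμ hμ hs hb hb'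
  set w := polar s b with hw
  have hwm : w ∈ resolventSet A :=
    hA.polar_mem_resolventSet hs (by linarith) (by linarith [hA.lt_pi])
  have hne : ∀ a, |a| = θ → ∀ ρ, 0 < ρ → w - polar ρ a ≠ 0 := fun a ha ρ hρ =>
    polar_sub_polar_ne_zero hs hb' (by linarith) hρ (by rintro rfl; linarith)
  have hi : ContourIntegrable θ (fun z => (f z / (w - z)) • resolvent A z) := by
    obtain ⟨C, hC, hB⟩ := hA.exists_bound_smul hf hμ hθ hθμ
    intro a ha
    obtain ⟨c, hc, h⟩ := exists_mul_le_norm_polar_sub' (a := b) (b := a) hb' (by linarith)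
      (by rintro rfl; linarith)
    have hfun : ∀ z, (f z / (w - z)) • resolvent A z = (w - z)⁻¹ • (f z • resolvent A z) := by
      intro z; rw [smul_smul, mul_comm, div_eq_mul_inv]
    simp only [hfun]
    refine rayIntegrable_of_bound (C := (c * s)⁻¹ * C) hA.neg_one_lt hA.lt_zero
      (fun ρ hρ => ?_) (fun ρ hρ => ?_)
    · exact ContinuousAt.smul (ContinuousAt.inv₀ (by fun_prop) (hne a ha ρ hρ))
        (hB ρ a hρ ha.ge (by rwa [ha])).1.continuousAt
    · rw [norm_smul, norm_inv, mul_assoc]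
      have h2 := h s ρ hs.le hρ.le
      have h3 : c * s ≤ ‖w - polar ρ a‖ := le_trans (by gcongr; linarith) h2
      gcongr
      exact (hB ρ a hρ ha.ge (by rwa [ha])).2
  have h1 := map_contour ((ContinuousLinearMap.mul ℂ (X →L[ℂ] X)).flip (resolvent A w)) h0
    (hA.contourIntegrable hf hμ hθ hθμ)
  have h2 := map_contour ((ContinuousLinearMap.id ℂ ℂ).smulRight (resolvent A w)) h0 hzi
  have hzi' : ContourIntegrable θ (fun z => (f z / (w - z)) • resolvent A w) := fun a ha =>
    (hzi a ha).clm_apply ((ContinuousLinearMap.id ℂ ℂ).smulRight (resolvent A w))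
  simp only [ContinuousLinearMap.flip_apply, ContinuousLinearMap.mul_apply',
    ContinuousLinearMap.smulRight_apply, ContinuousLinearMap.id_apply, hz, zero_smul] at h1 h2
  rw [funCalc_eq_contour, h1, ← sub_zero (contour θ fun z => (f z / (w - z)) • resolvent A z), h2,
    ← contour_sub h0 hi hzi']
  refine contour_congr h0 fun a ha ρ hρ => ?_
  have hm : polar ρ a ∈ resolventSet A :=
    hA.polar_mem_resolventSet hρ (by linarith) (by linarith [hA.lt_pi])
  rw [smul_mul_assoc, resolvent_mul_resolvent hm hwm (sub_ne_zero.1 (hne a ha ρ hρ)), smul_smul, ← smul_sub, div_eq_mul_inv]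

/-- Weighted AM-GM with weights `(1 + γ)/2` and `(1 - γ)/2`, chosen so that both variables get the
same exponent `(γ - 1)/2`, which lies in `(-1, 0)`. It separates the joint singularity of `1/(w -
z)` at the common vertex of two contours. -/
theorem rpow_div_add_le {γ ρ s : ℝ} (h1 : -1 < γ) (h0 : γ < 0) (hρ : 0 < ρ) (hs : 0 < s) :
    ρ ^ γ / (ρ + s) ≤ ρ ^ ((γ - 1) / 2) * s ^ ((γ - 1) / 2) := by
  rw [div_le_iff₀ (by positivity)]
  have h := Real.geom_mean_le_arith_mean2_weighted (w₁ := (1 + γ) / 2) (w₂ := (1 - γ) / 2)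
    (by linarith) (by linarith) hρ.le hs.le (by ring)
  have h2 : ρ ^ ((1 + γ) / 2) * s ^ ((1 - γ) / 2) ≤ ρ + s := by
    refine h.trans (add_le_add ?_ ?_)
    · exact mul_le_of_le_one_left hρ.le (by linarith)
    · exact mul_le_of_le_one_left hs.le (by linarith)
  calc ρ ^ γ = ρ ^ ((γ - 1) / 2) * s ^ ((γ - 1) / 2) *
        (ρ ^ ((1 + γ) / 2) * s ^ ((1 - γ) / 2)) := by
        rw [mul_mul_mul_comm, ← Real.rpow_add hρ, ← Real.rpow_add hs]
        ring_nf
        simp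
    _ ≤ _ := by gcongr

/-- The functional calculus is multiplicative. -/
theorem IsAlmostSectorial.funCalc_mul_funCalc (hA : IsAlmostSectorial γ ω A)
    (hf : IsDecaying μ f) (hg : IsDecaying μ g) (hμ : μ ≤ Real.pi) {θ : ℝ} (hθ : ω < θ)
    (hθμ : θ < μ) : funCalc A θ f * funCalc A θ g = funCalc A θ (fun z => f z * g z) := by
  have h0 : 0 ≤ θ := hA.nonneg.trans hθ.le
  obtain ⟨θ', hθθ', hθ'μ⟩ := exists_between hθμ
  have h0' : 0 ≤ θ' := h0.trans hθθ'.le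
  have hθ'π : θ' < Real.pi := hθ'μ.trans_le hμ
  obtain ⟨Cf, hCf, hfb⟩ := hA.exists_bound_smul hf hμ hθ hθμ
  obtain ⟨Cg, hCg, hgb⟩ := hg.bound_polar hμ
  obtain ⟨c, hc, hcb⟩ := exists_mul_le_norm_polar_sub
    (δ := min (θ' - θ) (2 * Real.pi - (θ' + θ)))
    (lt_min (by linarith) (by linarith))
    (by
      rcases le_total (θ' - θ) Real.pi with h | h
      · exact (min_le_left _ _).trans h
      · exact (min_le_right _ _).trans (by linarith))
  have hsep : ∀ a b : ℝ, |a| = θ → |b| = θ' → ∀ ρ s, 0 < ρ → 0 < s →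
      c * (ρ + s) ≤ ‖polar s b - polar ρ a‖ := by
    intro a b ha hb ρ s hρ hs
    rw [add_comm]
    refine hcb s ρ b a hs.le hρ.le ?_ ?_
    · refine (min_le_left _ _).trans ?_
      have := abs_sub_abs_le_abs_sub b a
      rwa [ha, hb] at this
    · have h1 := abs_sub b a
      have h2 := min_le_right (θ' - θ) (2 * Real.pi - (θ' + θ))
      rw [ha, hb] at h1
      linarith
  have hne : ∀ a b : ℝ, |a| = θ → |b| = θ' → ∀ ρ s, 0 < ρ → 0 < s →
      polar s b - polar ρ a ≠ 0 := by
    intro a b ha hb ρ s hρ hs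
    rw [← norm_pos_iff]
    exact lt_of_lt_of_le (by positivity) (hsep a b ha hb ρ s hρ hs)
  -- With `z` on the inner contour and `w` on the outer one, integrating first in `w` produces `g z`
  -- by Cauchy's formula, while integrating first in `z` produces `f(A) R(w)` by
  -- `funCalc_mul_resolvent`. Fubini equates the two results.
  set K : ℂ → ℂ → X →L[ℂ] X := fun z w => (g w / (w - z)) • (f z • resolvent A z) with hK
  have hKc : ∀ a b : ℝ, |a| = θ → |b| = θ' → ∀ ρ s, 0 < ρ → 0 < s →
      ContinuousAt (fun p : ℂ × ℂ => K p.1 p.2) (polar ρ a, polar s b) := by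
    intro a b ha hb ρ s hρ hs
    have h1 : ContinuousAt (fun p : ℂ × ℂ => g p.2) (polar ρ a, polar s b) :=
      ContinuousAt.comp (f := Prod.snd) (g := g)
        (hg.differentiableAt _ (polar_mem_openSector hμ hs (by rwa [hb]))).continuousAt
        continuousAt_snd
    have h2 : ContinuousAt (fun p : ℂ × ℂ => f p.1 • resolvent A p.1) (polar ρ a, polar s b) :=
      ContinuousAt.comp (f := Prod.fst) (g := fun z => f z • resolvent A z)
        (hfb ρ a hρ ha.ge (by rwa [ha])).1.continuousAt continuousAt_fst
    exact (h1.div (by fun_prop) (hne a b ha hb ρ s hρ hs)).smul h2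
  have hKb : ∀ a b : ℝ, |a| = θ → |b| = θ' → ∀ ρ s, 0 < ρ → 0 < s →
      ‖K (polar ρ a) (polar s b)‖ ≤
        (Cg * Cf / c) * (weight ((γ - 1) / 2) ρ * weight ((γ - 1) / 2) s) := by
    intro a b ha hb ρ s hρ hs
    have h1 := hgb s b hs (by rwa [hb])
    have h2 := (hfb ρ a hρ ha.ge (by rwa [ha])).2
    have h3 := hsep a b ha hb ρ s hρ hs
    have h4 := rpow_div_add_le hA.neg_one_lt hA.lt_zero hρ hs
    have h5 : 0 < c * (ρ + s) := by positivity
    simp only [hK]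
    rw [norm_smul, norm_div]
    calc _ ≤ Cg / (1 + s) / (c * (ρ + s)) * (Cf * weight γ ρ) := by gcongr
      _ = Cg * Cf / c / ((1 + ρ) * (1 + s)) * (ρ ^ γ / (ρ + s)) := by
        rw [weight]; field_simp
      _ ≤ Cg * Cf / c / ((1 + ρ) * (1 + s)) *
          (ρ ^ ((γ - 1) / 2) * s ^ ((γ - 1) / 2)) := by gcongr
      _ = _ := by rw [weight, weight]; field_simp
  have hβ1 : -1 < (γ - 1) / 2 := by linarith [hA.neg_one_lt]
  have hβ0 : (γ - 1) / 2 < 0 := by linarith [hA.lt_zero]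
  have hswap := contour_contour_swap h0 h0' hβ1 hβ0 hKc hKb
  have hleft : contour θ (fun z => contour θ' (fun w => K z w)) =
      funCalc A θ (fun z => f z * g z) := by
    rw [funCalc_eq_contour]
    refine contour_congr h0 fun a ha ρ hρ => ?_
    obtain ⟨h1, h2⟩ := contour_div_sub (f := g) (s := ρ) (b := a) hg hθ'μ hμ hρ (by rwa [ha])
    have h3 := map_contour ((ContinuousLinearMap.id ℂ ℂ).smulRight
      (f (polar ρ a) • resolvent A (polar ρ a))) h0' h2
    simp only [ContinuousLinearMap.smulRight_apply, ContinuousLinearMap.id_apply, h1] at h3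
    rw [← h3, smul_smul, mul_comm]
  have hright : contour θ' (fun w => contour θ (fun z => K z w)) =
      funCalc A θ f * funCalc A θ' g := by
    have h1 := map_contour (ContinuousLinearMap.mul ℂ (X →L[ℂ] X) (funCalc A θ f)) h0'
      (hA.contourIntegrable hg hμ (hθ.trans hθθ') hθ'μ)
    simp only [ContinuousLinearMap.mul_apply'] at h1
    rw [funCalc_eq_contour A θ' g, h1]
    refine contour_congr h0' fun b hb s hs => ?_
    rw [mul_smul_comm, hA.funCalc_mul_resolvent hf hμ hθ hθμ hs (by rwa [hb]) (by rwa [hb]),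
      ← contour_smul]
    refine contour_congr h0 fun a ha ρ hρ => ?_
    simp only [hK]
    rw [smul_smul, smul_smul]
    congr 1
    ring
  rw [hA.funCalc_eq_funCalc hg hμ hθ hθθ'.le hθ'μ, ← hright, ← hswap, hleft]

theorem polar_sub_two_pi (ρ y : ℝ) : polar ρ (y - 2 * Real.pi) = polar ρ y := by
  rw [polar, polar]
  congr 1
  rw [← Complex.exp_periodic.sub_eq (y * Complex.I)]
  congr 1; push_cast; ring

theorem ray_sub_two_pi {E : Type*} [NormedAddCommGroup E] [NormedSpace ℂ E] (a : ℝ) (F : ℂ → E) :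
    ray (a - 2 * Real.pi) F = ray a F := by
  have : Complex.exp ((a - 2 * Real.pi : ℝ) * Complex.I) = Complex.exp (a * Complex.I) := by
    simpa [polar] using polar_sub_two_pi 1 a
  simp only [ray, polar_sub_two_pi, this]

/-- `(1 + z)⁻¹(A) = (1 + A)⁻¹`. -/
theorem IsAlmostSectorial.funCalc_one_add_inv (hA : IsAlmostSectorial γ ω A) {θ : ℝ} (hθ : ω < θ)
    (hθπ : θ < Real.pi) : funCalc A θ (fun z => (1 + z)⁻¹) = invOneAdd A := by
  have h0 : 0 < θ := hA.nonneg.trans_lt hθ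
  obtain ⟨μ, hθμ, hμπ⟩ := exists_between hθπ
  have hm := hA.neg_one_mem
  have hi := hA.contourIntegrable (isDecaying_one_add_inv (by linarith) hμπ) hμπ.le hθ hθμ
  have hpol1 : polar 1 0 = 1 := by simp [polar]
  have hk := contour_cauchyKernel (θ := θ) (b := 0) one_pos (by simpa using h0) hθπ
  have hki : ContourIntegrable θ (cauchyKernel 1) := fun a ha => by
    rw [← hpol1]
    exact rayIntegrable_cauchyKernel one_pos (by rwa [ha]) (by simpa using Real.pi_pos)
      (by rintro rfl; rw [abs_zero] at ha; exact h0.ne ha)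
  rw [hpol1] at hk
  have hsmulk := map_contour ((ContinuousLinearMap.id ℂ ℂ).smulRight (resolvent A (-1))) h0.le hki
  have hki' : ContourIntegrable θ (fun z => cauchyKernel 1 z • resolvent A (-1)) := fun a ha =>
    (hki a ha).clm_apply ((ContinuousLinearMap.id ℂ ℂ).smulRight (resolvent A (-1)))
  simp only [ContinuousLinearMap.smulRight_apply, ContinuousLinearMap.id_apply, hk,
    one_smul] at hsmulk
  -- On the resolvent set, away from `±1`, `G z = (1 + z)⁻¹ R(z) + cauchyKernel 1 z • R(-1)`. The
  -- poles at `-1` cancel, and the pole at `1` is not in the sector containing the negative axis.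
  -- Turning the contour through that sector gives `0`; as the kernel integrates to `1`, what
  -- remains is `(1 + z)⁻¹(A) = -R(-1)`.
  set G : ℂ → X →L[ℂ] X := fun z =>
    -(resolvent A z * resolvent A (-1)) - (1 - z)⁻¹ • resolvent A (-1) with hG
  have hmem : ∀ ρ y, 0 < ρ → θ ≤ y → y ≤ 2 * Real.pi - θ → polar ρ y ∈ resolventSet A := by
    intro ρ y hρ h1 h2
    have hy : |y| = y := abs_of_nonneg (by linarith)
    exact hA.polar_mem_resolventSet hρ (by linarith) (by linarith)
  have hGeq : ∀ z, z ∈ resolventSet A → 1 + z ≠ 0 → 1 - z ≠ 0 →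
      G z = (1 + z)⁻¹ • resolvent A z + cauchyKernel 1 z • resolvent A (-1) := by
    intro z hz h1 h2
    have h3 : (-1 : ℂ) ≠ z := by
      rintro rfl; exact h1 (by norm_num)
    have h4 : z - 1 ≠ 0 := by rw [← neg_ne_zero, neg_sub]; exact h2
    have h5 : (-1 - z)⁻¹ = -(1 + z)⁻¹ := by
      rw [← inv_neg]; congr 1; ring
    have h6 : cauchyKernel 1 z = -(1 - z)⁻¹ - (1 + z)⁻¹ := by
      rw [cauchyKernel, ← inv_neg, neg_sub, one_div, one_div]
    simp only [hG]
    rw [resolvent_mul_resolvent hz hm h3, h5, h6, sub_smul, neg_smul, neg_smul, smul_sub]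
    abel
  have hsub : ∀ ρ y, 0 < ρ → θ ≤ y → y ≤ 2 * Real.pi - θ → 1 - polar ρ y ≠ 0 := by
    intro ρ y hρ h1 h2 h3
    obtain ⟨c, hc, h⟩ := exists_mul_le_norm_polar_sub h0 hθπ.le
    have h4 := h 1 ρ 0 y zero_le_one hρ.le
    rw [hpol1, h3, zero_sub, abs_neg, abs_of_nonneg (by linarith), norm_zero] at h4
    exact absurd (h4 h1 h2) (not_le.2 (by positivity))
  obtain ⟨C, hC, hb⟩ := hA.exists_bound hθ hθπ.le
  have hGi : ContourIntegrable θ G := by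
    intro a ha
    refine IntegrableOn.congr_fun ((hi a ha).add (hki' a ha)) (fun ρ hρ => ?_) measurableSet_Ioi
    refine (hGeq _ (hA.polar_mem_resolventSet hρ (by linarith) (by linarith [hA.lt_pi]))
      (one_add_polar_ne_zero hρ (by rwa [ha])) ?_).symm
    rw [← hpol1]
    exact polar_sub_polar_ne_zero one_pos (by simpa using Real.pi_pos) (by rwa [ha]) hρ
      (by rintro rfl; rw [abs_zero] at ha; exact h0.ne ha)
  have hzero : contour θ G = 0 := by
    have h1 : |-θ| = θ := by rw [abs_neg, abs_of_pos h0]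
    have h2 := hGi _ h1
    have h3 : RayIntegrable (2 * Real.pi - θ) G := by
      have h4 : -θ = 2 * Real.pi - θ - 2 * Real.pi := by ring
      rw [h4] at h2
      simpa only [RayIntegrable, polar_sub_two_pi] using h2
    have h5 : ray θ G = ray (2 * Real.pi - θ) G := by
      -- For `ρ < 1/2` or `ρ > 2` both `|z - 1|` and `|z + 1|` are at least `(1 + ρ)/3`. The
      -- constant `3` comes from `(1 + z)⁻¹`, and `18 = 2 · 3 · 3` from the kernel `2/((z - 1)(z +
      -- 1))`.
      refine ray_eq_ray (r := 1 / 2) (R := 2) (C := 3 * C + 18 * ‖resolvent A (-1)‖) (by linarith)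
        hA.neg_one_lt hA.lt_zero (by norm_num) ?_ ?_ (hGi _ (abs_of_pos h0)) h3
      · intro y hy ρ hρ
        have h6 := differentiableAt_resolvent (hmem ρ y hρ hy.1 hy.2)
        have h7 := hsub ρ y hρ hy.1 hy.2
        exact ((h6.mul (differentiableAt_const _)).neg).sub
          (DifferentiableAt.smul (DifferentiableAt.inv (by fun_prop) h7) (differentiableAt_const _))
      · intro y hy ρ hρ hr
        have h6 := hsub ρ y hρ hy.1 hy.2
        have hy' : |y| = y := abs_of_nonneg (by linarith [hy.1])
        have h7 := hb ρ y hρ (by linarith [hy.1]) (by linarith [hy.2])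
        have hfar : ∀ e : ℂ, ‖e‖ = 1 → 1 / 3 * (1 + ρ) ≤ ‖polar ρ y - e‖ := by
          intro e he
          have h8 := abs_norm_sub_norm_le (polar ρ y) e
          rw [norm_polar hρ.le, he] at h8
          refine le_trans ?_ h8
          rcases hr with h | h
          · rw [abs_of_neg (by linarith)]; linarith
          · rw [abs_of_pos (by linarith)]; linarith
        have h8 := hfar 1 (by simp)
        have h9 := hfar (-1) (by simp)
        rw [sub_neg_eq_add, add_comm (polar ρ y)] at h9
        have h10 : 0 < 1 / 3 * (1 + ρ) := by positivity
        have h11 : 1 + polar ρ y ≠ 0 := norm_pos_iff.1 (h10.trans_le h9)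
        have h12 : polar ρ y - 1 ≠ 0 := norm_pos_iff.1 (h10.trans_le h8)
        have h13 : cauchyKernel 1 (polar ρ y) = 2 / (polar ρ y - 1) / (1 + polar ρ y) := by
          rw [cauchyKernel]; field_simp; ring
        rw [hGeq _ (hmem ρ y hρ hy.1 hy.2) h11 h6, h13]
        refine (norm_add_le _ _).trans ?_
        rw [norm_smul, norm_smul, norm_inv, norm_div, norm_div, add_mul]
        refine add_le_add ?_ ?_
        · calc _ ≤ (1 / 3 * (1 + ρ))⁻¹ * (C * ρ ^ γ) := by gcongr
            _ = _ := by rw [weight]; field_simp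
        · calc _ ≤ ‖(2 : ℂ)‖ / (1 / 3 * (1 + ρ)) / (1 / 3 * (1 + ρ)) * ‖resolvent A (-1)‖ := by
                gcongr
            _ = 18 * ‖resolvent A (-1)‖ * (1 / (1 + ρ) / (1 + ρ)) := by
                rw [Complex.norm_ofNat]; field_simp; norm_num; ring
            _ ≤ _ := by
                gcongr; exact one_div_sq_le_weight hA.neg_one_lt hA.lt_zero hρ
    have h6 : ray (-θ) G = ray (2 * Real.pi - θ) G := by
      rw [← ray_sub_two_pi (2 * Real.pi - θ)]
      congr 1; ring
    rw [contour, h5, h6, sub_self, smul_zero]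
  have hsum : contour θ G = funCalc A θ (fun z => (1 + z)⁻¹) + resolvent A (-1) := by
    rw [funCalc_eq_contour, hsmulk, ← contour_add h0.le hi hki']
    refine contour_congr h0.le fun a ha ρ hρ => ?_
    refine hGeq _ (hA.polar_mem_resolventSet hρ (by linarith) (by linarith [hA.lt_pi]))
      (one_add_polar_ne_zero hρ (by rwa [ha])) ?_
    rw [← hpol1]
    exact polar_sub_polar_ne_zero one_pos (by simpa using Real.pi_pos) (by rwa [ha]) hρ
      (by rintro rfl; rw [abs_zero] at ha; exact h0.ne ha)
  rw [invOneAdd, eq_neg_iff_add_eq_zero, ← hsum, hzero]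

/-- `((1 + z)⁻ⁿ f)(A) = (1 + A)⁻ⁿ f(A)`. -/
theorem IsAlmostSectorial.invOneAdd_pow_mul_funCalc (hA : IsAlmostSectorial γ ω A)
    (hf : IsDecaying μ f) (hμ : μ < Real.pi) {θ : ℝ} (hθ : ω < θ) (hθμ : θ < μ) (n : ℕ) :
    IsDecaying μ (fun z => ((1 + z)⁻¹) ^ n * f z) ∧
    funCalc A θ (fun z => ((1 + z)⁻¹) ^ n * f z) = invOneAdd A ^ n * funCalc A θ f := by
  have hone := isDecaying_one_add_inv ((hA.nonneg.trans hθ.le).trans hθμ.le) hμ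
  induction n with
  | zero => simpa using hf
  | succ n ih =>
    have h1 : (fun z : ℂ => ((1 + z)⁻¹) ^ (n + 1) * f z) =
        fun z => (1 + z)⁻¹ * (((1 + z)⁻¹) ^ n * f z) := by
      ext z; rw [pow_succ']; ring
    rw [h1, ← hA.funCalc_mul_funCalc hone ih.1 hμ.le hθ hθμ, ih.2,
      hA.funCalc_one_add_inv hθ (hθμ.trans hμ), pow_succ', mul_assoc]
    exact ⟨hone.mul ih.1, rfl⟩

end Calculus

/-! ### Contour integrals depending on a parameter -/

section Parameter

variable {E : Type*} [NormedAddCommGroup E] [NormedSpace ℂ E]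

theorem contour_hasDerivAt {θ C β : ℝ} (hθ : 0 ≤ θ) (h1 : -1 < β) (h0 : β < 0)
    {F F' : ℂ → ℂ → E} {τ₀ : ℂ} {s : Set ℂ} (hs : s ∈ 𝓝 τ₀)
    (hi : ∀ τ ∈ s, ContourIntegrable θ (F τ)) (hi' : ContourIntegrable θ (F' τ₀))
    (hb : ∀ τ ∈ s, ∀ a : ℝ, |a| = θ → ∀ ρ, 0 < ρ → ‖F' τ (polar ρ a)‖ ≤ C * weight β ρ)
    (hd : ∀ τ ∈ s, ∀ z, HasDerivAt (fun τ => F τ z) (F' τ z) τ) :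
    HasDerivAt (fun τ => contour θ (F τ)) (contour θ (F' τ₀)) τ₀ := by
  have key : ∀ a : ℝ, |a| = θ → HasDerivAt (fun τ => ray a (F τ)) (ray a (F' τ₀)) τ₀ := by
    intro a ha
    refine (hasDerivAt_integral_of_dominated_loc_of_deriv_le (μ := volume.restrict (Ioi 0))
      (F := fun τ ρ => Complex.exp (a * Complex.I) • F τ (polar ρ a))
      (F' := fun τ ρ => Complex.exp (a * Complex.I) • F' τ (polar ρ a))
      (bound := fun ρ => C * weight β ρ) hs ?_ ?_ ?_ ?_ ?_ ?_).2
    · filter_upwards [hs] with τ hτ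
      exact (Integrable.smul (Complex.exp (a * Complex.I)) (hi τ hτ a ha)).aestronglyMeasurable
    · exact Integrable.smul (Complex.exp (a * Complex.I)) (hi τ₀ (mem_of_mem_nhds hs) a ha)
    · exact (Integrable.smul (Complex.exp (a * Complex.I)) (hi' a ha)).aestronglyMeasurable
    · refine (ae_restrict_iff' measurableSet_Ioi).2 (ae_of_all _ fun ρ hρ τ hτ => ?_)
      rw [norm_smul, Complex.norm_exp_ofReal_mul_I, one_mul]
      exact hb τ hτ a ha ρ hρ
    · exact (integrableOn_weight h1 h0).const_mul C
    · exact ae_of_all _ fun ρ τ hτ => (hd τ hτ _).const_smul _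
  exact ((key _ (by rw [abs_neg, abs_of_nonneg hθ])).sub (key _ (abs_of_nonneg hθ))).const_smul _

theorem contour_tendsto {ι : Type*} {l : Filter ι} [l.IsCountablyGenerated] {θ C β : ℝ}
    (hθ : 0 ≤ θ) (h1 : -1 < β) (h0 : β < 0) {F : ι → ℂ → E} {G : ℂ → E}
    (hi : ∀ᶠ i in l, ContourIntegrable θ (F i))
    (hb : ∀ᶠ i in l, ∀ a : ℝ, |a| = θ → ∀ ρ, 0 < ρ → ‖F i (polar ρ a)‖ ≤ C * weight β ρ)
    (hl : ∀ z, Tendsto (fun i => F i z) l (𝓝 (G z))) :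
    Tendsto (fun i => contour θ (F i)) l (𝓝 (contour θ G)) := by
  have key : ∀ a : ℝ, |a| = θ → Tendsto (fun i => ray a (F i)) l (𝓝 (ray a G)) := by
    intro a ha
    refine tendsto_integral_filter_of_dominated_convergence (fun ρ => C * weight β ρ) ?_ ?_ ?_ ?_
    · filter_upwards [hi] with i hi
      exact (Integrable.smul (Complex.exp (a * Complex.I)) (hi a ha)).aestronglyMeasurable
    · filter_upwards [hb] with i hb
      refine (ae_restrict_iff' measurableSet_Ioi).2 (ae_of_all _ fun ρ hρ => ?_)
      rw [norm_smul, Complex.norm_exp_ofReal_mul_I, one_mul]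
      exact hb a ha ρ hρ
    · exact (integrableOn_weight h1 h0).const_mul C
    · exact ae_of_all _ fun ρ => (hl _).const_smul _
  exact ((key _ (by rw [abs_neg, abs_of_nonneg hθ])).sub (key _ (abs_of_nonneg hθ))).const_smul _

end Parameter

/-! ### Decay of `(z^α)ᵏ e^{-τ z^α}` and of the regularized power -/

section Exponential

/-- The functions `(z^α)ᵏ e^{-τ z^α}`. -/
def powExp (α : ℝ) (k : ℕ) (τ z : ℂ) : ℂ :=
  (z ^ (α : ℂ)) ^ k * Complex.exp (-(τ * z ^ (α : ℂ)))

/-- `Re (τ ζ) ≥ decayRate c τ * |ζ|` for all `ζ` with `Re ζ ≥ c |ζ|`, if `Re τ ≥ 0`. -/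
def decayRate (c : ℝ) (τ : ℂ) : ℝ := c * τ.re - |τ.im|

theorem continuous_decayRate (c : ℝ) : Continuous (decayRate c) := by
  unfold decayRate; fun_prop

theorem decayRate_ofReal (c t : ℝ) : decayRate c t = c * t := by simp [decayRate]

theorem convex_decayRate_pos (c : ℝ) : Convex ℝ {τ | 0 < decayRate c τ} := by
  intro τ hτ σ hσ a b ha hb hab
  simp only [mem_ofPred_eq, decayRate, Complex.add_re, Complex.add_im, Complex.real_smul,
    Complex.re_ofReal_mul, Complex.im_ofReal_mul] at *
  have h := abs_add_le (a * τ.im) (b * σ.im)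
  rw [abs_mul, abs_mul, abs_of_nonneg ha, abs_of_nonneg hb] at h
  rcases ha.eq_or_lt with rfl | ha'
  · have : b = 1 := by linarith
    subst this; nlinarith
  · nlinarith [mul_pos ha' hτ, mul_nonneg hb hσ.le]

theorem cos_mul_le_re_polar {ψ r y : ℝ} (hr : 0 ≤ r) (hψ : ψ < Real.pi / 2) (hy : |y| ≤ ψ) :
    Real.cos ψ * r ≤ (polar r y).re := by
  rw [polar, Complex.re_ofReal_mul, Complex.exp_ofReal_mul_I_re, mul_comm]
  gcongr
  rw [← Real.cos_abs y]
  exact Real.cos_le_cos_of_nonneg_of_le_pi (abs_nonneg _) (by linarith [Real.pi_pos]) hy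

variable {α μ : ℝ}

/-- Since `αμ < π/2`, the power `z^α` stays in a sector where `Re z^α ≥ cos(αμ) |z|^α`; the
imaginary part of `τ` costs at most `|Im τ| |z|^α`. -/
theorem norm_powExp_le (hα : 0 < α) (hμ : μ ≤ Real.pi) (hαμ : α * μ < Real.pi / 2) {k : ℕ}
    {τ z : ℂ} (hτ : 0 ≤ τ.re) (hz : z ∈ openSector μ) :
    ‖powExp α k τ z‖ ≤ (‖z‖ ^ α) ^ k *
      Real.exp (-(decayRate (Real.cos (α * μ)) τ * ‖z‖ ^ α)) := by
  obtain ⟨ρ, y, hρ, hy, rfl⟩ := exists_polar_of_mem_openSector hz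
  have hρα : 0 ≤ ρ ^ α := Real.rpow_nonneg hρ.le α
  have h1 : |α * y| ≤ α * μ := by
    rw [abs_mul, abs_of_pos hα]; gcongr
  rw [powExp, polar_cpow hρ (hy.trans_le hμ), norm_mul, norm_pow, norm_polar hρα,
    norm_polar hρ.le, Complex.norm_exp]
  gcongr
  rw [Complex.neg_re, Complex.mul_re]
  have h2 := cos_mul_le_re_polar hρα hαμ h1
  have h3 : |(polar (ρ ^ α) (α * y)).im| ≤ ρ ^ α :=
    (Complex.abs_im_le_norm _).trans (norm_polar hρα _).le
  have h4 : τ.im * (polar (ρ ^ α) (α * y)).im ≤ |τ.im| * ρ ^ α := by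
    refine (le_abs_self _).trans ?_
    rw [abs_mul]; gcongr
  have h5 := mul_le_mul_of_nonneg_left h2 hτ
  rw [decayRate]
  nlinarith

theorem exists_pow_mul_exp_neg_le (hα : 0 < α) (k : ℕ) {κ : ℝ} (hκ : 0 < κ) :
    ∃ C : ℝ, 0 ≤ C ∧ ∀ ρ, 0 < ρ → (ρ ^ α) ^ k * Real.exp (-(κ * ρ ^ α)) ≤ C / (1 + ρ) := by
  -- With `x = ρ^α` one has `x^k ρ = x^(k + 1/α)`, so this `N` bounds both `x^k` and `x^k ρ` by `1 +
  -- x^N`. One term of the exponential series then controls `x^N e^{-κx}`.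
  obtain ⟨N, hN⟩ := exists_nat_ge (k + 1 / α)
  refine ⟨2 * (1 + N.factorial / κ ^ N), by positivity, fun ρ hρ => ?_⟩
  set x := ρ ^ α with hx
  have hx0 : 0 < x := Real.rpow_pos_of_pos hρ α
  have hρx : ρ = x ^ (1 / α) := by
    rw [hx, ← Real.rpow_mul hρ.le, mul_one_div_cancel hα.ne', Real.rpow_one]
  have hpow : ∀ p : ℝ, 0 ≤ p → p ≤ N → x ^ p ≤ 1 + x ^ N := by
    intro p hp hpN
    rcases le_total x 1 with h | h
    · exact (Real.rpow_le_one hx0.le h hp).trans (by linarith [pow_pos hx0 N])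
    · have := Real.rpow_le_rpow_of_exponent_le h hpN
      rw [Real.rpow_natCast] at this
      linarith
  have hαi : 0 < 1 / α := by positivity
  have h1 : x ^ k ≤ 1 + x ^ N := by
    have := hpow k (by positivity) (by linarith)
    rwa [Real.rpow_natCast] at this
  have h2 : x ^ k * ρ ≤ 1 + x ^ N := by
    have := hpow (k + 1 / α) (by positivity) hN
    rwa [Real.rpow_add hx0, Real.rpow_natCast, ← hρx] at this
  have h3 : x ^ N * Real.exp (-(κ * x)) ≤ N.factorial / κ ^ N := by
    have := Real.pow_div_factorial_le_exp (κ * x) (by positivity) N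
    rw [mul_pow, div_le_iff₀ (by positivity)] at this
    rw [Real.exp_neg, ← div_eq_mul_inv, div_le_div_iff₀ (Real.exp_pos _) (by positivity)]
    linarith
  have h4 : Real.exp (-(κ * x)) ≤ 1 := Real.exp_le_one_iff.2 (by nlinarith)
  rw [le_div_iff₀ (by positivity)]
  calc x ^ k * Real.exp (-(κ * x)) * (1 + ρ)
      = (x ^ k + x ^ k * ρ) * Real.exp (-(κ * x)) := by ring
    _ ≤ (2 * (1 + x ^ N)) * Real.exp (-(κ * x)) := by gcongr; linarith
    _ = 2 * (Real.exp (-(κ * x)) + x ^ N * Real.exp (-(κ * x))) := by ring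
    _ ≤ _ := by gcongr

theorem re_nonneg_of_decayRate_pos {c : ℝ} (hc : 0 < c) {τ : ℂ} (hτ : 0 < decayRate c τ) :
    0 ≤ τ.re := by
  rw [decayRate] at hτ
  have : 0 < c * τ.re := by linarith [abs_nonneg τ.im]
  exact (pos_of_mul_pos_right this hc.le).le

theorem cos_mul_pos (hα : 0 < α) (hμ0 : 0 ≤ μ) (hαμ : α * μ < Real.pi / 2) :
    0 < Real.cos (α * μ) :=
  Real.cos_pos_of_mem_Ioo ⟨by nlinarith [Real.pi_pos, mul_nonneg hα.le hμ0], hαμ⟩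

/-- A bound for `powExp` which is uniform for `τ` with decay rate at least `κ`. -/
theorem exists_norm_powExp_le (hα : 0 < α) (hμ0 : 0 ≤ μ) (hμ : μ ≤ Real.pi)
    (hαμ : α * μ < Real.pi / 2) (k : ℕ) {κ : ℝ} (hκ : 0 < κ) :
    ∃ C : ℝ, 0 ≤ C ∧ ∀ τ, κ ≤ decayRate (Real.cos (α * μ)) τ → ∀ z ∈ openSector μ,
      ‖powExp α k τ z‖ ≤ C / (1 + ‖z‖) := by
  obtain ⟨C, hC, h⟩ := exists_pow_mul_exp_neg_le hα k hκ
  refine ⟨C, hC, fun τ hτ z hz => ?_⟩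
  have hz0 : 0 < ‖z‖ := norm_pos_iff.2 (Complex.slitPlane_ne_zero hz.1)
  refine (norm_powExp_le hα hμ hαμ (re_nonneg_of_decayRate_pos (cos_mul_pos hα hμ0 hαμ)
    (hκ.trans_le hτ)) hz).trans (le_trans ?_ (h _ hz0))
  gcongr

theorem differentiableAt_cpow_openSector {z : ℂ} (hz : z ∈ openSector μ) :
    DifferentiableAt ℂ (fun z : ℂ => z ^ (α : ℂ)) z :=
  differentiableAt_id.cpow_const hz.1

theorem isDecaying_powExp (hα : 0 < α) (hμ0 : 0 ≤ μ) (hμ : μ ≤ Real.pi)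
    (hαμ : α * μ < Real.pi / 2) (k : ℕ) {τ : ℂ} (hτ : 0 < decayRate (Real.cos (α * μ)) τ) :
    IsDecaying μ (powExp α k τ) := by
  constructor
  · intro z hz
    have := differentiableAt_cpow_openSector (α := α) hz
    unfold powExp
    fun_prop
  · obtain ⟨C, hC, h⟩ := exists_norm_powExp_le hα hμ0 hμ hαμ k hτ
    exact ⟨C, hC, fun z hz => h τ le_rfl z hz⟩

theorem hasDerivAt_powExp (k : ℕ) (τ z : ℂ) :
    HasDerivAt (fun τ => powExp α k τ z) (-powExp α (k + 1) τ z) τ := by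
  have h1 : HasDerivAt (fun τ : ℂ => -(τ * z ^ (α : ℂ))) (-(1 * z ^ (α : ℂ))) τ :=
    ((hasDerivAt_id τ).mul_const _).neg
  have h2 := h1.cexp.const_mul ((z ^ (α : ℂ)) ^ k)
  refine h2.congr_deriv ?_
  simp only [powExp, pow_succ]; ring

/-- The regularized power `z^α (1 + z)^{-m}`. -/
def regPow (α : ℝ) (z : ℂ) : ℂ := z ^ (α : ℂ) * ((1 + z) ^ regExponent α)⁻¹

theorem isDecaying_regPow (hα : 0 < α) (hμ0 : 0 ≤ μ) (hμ : μ < Real.pi) :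
    IsDecaying μ (regPow α) := by
  obtain ⟨c, hc, h⟩ := exists_mul_le_norm_one_add_polar hμ0 hμ
  constructor
  · intro z hz
    have := differentiableAt_cpow_openSector (α := α) hz
    obtain ⟨ρ, y, hρ, hy, rfl⟩ := exists_polar_of_mem_openSector hz
    have h1 := pow_ne_zero (regExponent α) (one_add_polar_ne_zero hρ (hy.trans hμ))
    unfold regPow
    fun_prop (disch := assumption)
  · refine ⟨(c ^ regExponent α)⁻¹, by positivity, fun z hz => ?_⟩
    obtain ⟨ρ, y, hρ, hy, rfl⟩ := exists_polar_of_mem_openSector hz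
    have h1 := h ρ y hρ.le hy.le
    have h2 : ρ ^ α ≤ (1 + ρ) ^ (⌊α⌋₊ + 1) := by
      calc ρ ^ α ≤ (1 + ρ) ^ α := by gcongr; linarith
        _ ≤ (1 + ρ) ^ ((⌊α⌋₊ + 1 : ℕ) : ℝ) := by
          refine Real.rpow_le_rpow_of_exponent_le (by linarith) ?_
          push_cast
          exact (Nat.lt_floor_add_one α).le
        _ = _ := Real.rpow_natCast _ _
    rw [regPow, polar_cpow hρ (hy.trans hμ), norm_mul, norm_polar (Real.rpow_nonneg hρ.le _),
      norm_polar hρ.le, norm_inv, norm_pow]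
    calc ρ ^ α * (‖1 + polar ρ y‖ ^ regExponent α)⁻¹
        ≤ (1 + ρ) ^ (⌊α⌋₊ + 1) * ((c * (1 + ρ)) ^ regExponent α)⁻¹ := by gcongr
      _ = _ := by
        have h3 : regExponent α = ⌊α⌋₊ + 1 + 1 := rfl
        rw [mul_pow, h3, pow_succ (1 + ρ) (⌊α⌋₊ + 1)]
        field_simp

end Exponential

/-! ### The operators `e^{-τ A^α}` and their relation to `A^α` -/

section Semigroup

variable {X : Type*} [NormedAddCommGroup X] [NormedSpace ℂ X] {A : X →ₗ.[ℂ] X} {γ ω α θ : ℝ}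

/-- The operators `(z^α)ᵏ e^{-τ z^α}(A)`, for complex times `τ`. -/
def powSemigroup (A : X →ₗ.[ℂ] X) (α θ : ℝ) (k : ℕ) (τ : ℂ) : X →L[ℂ] X :=
  funCalc A θ (powExp α k τ)

theorem semigroupOp_eq (A : X →ₗ.[ℂ] X) (α θ t : ℝ) :
    semigroupOp A α θ t = powSemigroup A α θ 0 t := by
  rw [semigroupOp, powSemigroup]
  congr 1
  ext z
  rw [powExp, pow_zero, one_mul]

/-- Admissible parameters, together with an angle `μ > θ` for which `e^{-z^α}` still decays. -/
structure Admissible (A : X →ₗ.[ℂ] X) (γ ω α θ μ : ℝ) : Prop where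
  isAlmostSectorial : IsAlmostSectorial γ ω A
  pos : 0 < α
  lt_angle : ω < θ
  lt_outer : θ < μ
  outer_lt_pi : μ < Real.pi
  outer_mul_lt : α * μ < Real.pi / 2

variable {μ : ℝ}

/-- The room left above `θ` is where the second contour of the multiplicativity proof lies. -/
theorem exists_admissible (hA : IsAlmostSectorial γ ω A) (hα : 0 < α) (hθ : ω < θ)
    (hθ' : θ < min Real.pi (Real.pi / (2 * α))) : ∃ μ, Admissible A γ ω α θ μ := by
  obtain ⟨μ, h1, h2⟩ := exists_between hθ'
  rw [lt_min_iff, lt_div_iff₀ (by positivity)] at h2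
  exact ⟨μ, hA, hα, hθ, h1, h2.1, by linarith [h2.2]⟩

namespace Admissible

theorem angle_nonneg (h : Admissible A γ ω α θ μ) : 0 ≤ θ :=
  h.isAlmostSectorial.nonneg.trans h.lt_angle.le

theorem outer_nonneg (h : Admissible A γ ω α θ μ) : 0 ≤ μ := h.angle_nonneg.trans h.lt_outer.le

theorem cos_pos (h : Admissible A γ ω α θ μ) : 0 < Real.cos (α * μ) :=
  cos_mul_pos h.pos h.outer_nonneg h.outer_mul_lt

theorem decayRate_pos (h : Admissible A γ ω α θ μ) {t : ℝ} (ht : 0 < t) :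
    0 < decayRate (Real.cos (α * μ)) t := by
  rw [decayRate_ofReal]; exact mul_pos h.cos_pos ht

theorem isDecaying (h : Admissible A γ ω α θ μ) (k : ℕ) {τ : ℂ}
    (hτ : 0 < decayRate (Real.cos (α * μ)) τ) : IsDecaying μ (powExp α k τ) :=
  isDecaying_powExp h.pos h.outer_nonneg h.outer_lt_pi.le h.outer_mul_lt k hτ

/-- Injectivity of `(1 + A)^{-m}` makes the defining relation single-valued, so the partial map
built from it has exactly this graph. -/
theorem mem_fracPow_iff (h : Admissible A γ ω α θ μ) {x y : X} :
    (∃ hx : x ∈ (fracPow A α θ).domain, fracPow A α θ ⟨x, hx⟩ = y) ↔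
      funCalc A θ (regPow α) x = (invOneAdd A ^ regExponent α) y := by
  have hinj := h.isAlmostSectorial.invOneAdd_pow_injective (regExponent α)
  have hg : ∀ p ∈ fracPowGraph A α θ, p.1 = 0 → p.2 = 0 := by
    intro p hp hp1
    have hp : funCalc A θ (regPow α) p.1 = (invOneAdd A ^ regExponent α) p.2 := hp
    rw [hp1, map_zero] at hp
    exact hinj (hp.symm.trans (map_zero _).symm)
  have h1 : (x, y) ∈ (fracPow A α θ).graph ↔ (x, y) ∈ fracPowGraph A α θ := by
    rw [fracPow, Submodule.toLinearPMap_graph_eq _ hg]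
  refine Iff.trans ?_ h1
  rw [LinearPMap.mem_graph_iff]
  constructor
  · rintro ⟨hx, hy⟩
    exact ⟨⟨x, hx⟩, rfl, hy⟩
  · rintro ⟨⟨x', hx'⟩, hx, hy⟩
    have hx : x' = x := hx
    subst hx
    exact ⟨hx', hy⟩

variable [CompleteSpace X]

theorem hasDerivAt_powSemigroup (h : Admissible A γ ω α θ μ) (k : ℕ) {τ : ℂ}
    (hτ : 0 < decayRate (Real.cos (α * μ)) τ) :
    HasDerivAt (powSemigroup A α θ k) (-powSemigroup A α θ (k + 1) τ) τ := by
  have hA := h.isAlmostSectorial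
  -- Half the decay rate at `τ` is still exceeded on a neighbourhood of `τ`, which gives one
  -- majorant for differentiation under the integral.
  set κ := decayRate (Real.cos (α * μ)) τ / 2 with hκ
  have hκ0 : 0 < κ := by positivity
  obtain ⟨C, hC, hb⟩ := exists_norm_powExp_le h.pos h.outer_nonneg h.outer_lt_pi.le
    h.outer_mul_lt (k + 1) hκ0
  obtain ⟨D, hD, hR⟩ := hA.exists_bound h.lt_angle (h.lt_outer.le.trans h.outer_lt_pi.le)
  have hs : {σ : ℂ | κ < decayRate (Real.cos (α * μ)) σ} ∈ 𝓝 τ :=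
    (isOpen_lt continuous_const (continuous_decayRate _)).mem_nhds (by
      change κ < decayRate (Real.cos (α * μ)) τ
      linarith)
  have hint := fun (j : ℕ) (σ : ℂ) (hσ : 0 < decayRate (Real.cos (α * μ)) σ) =>
    hA.contourIntegrable (h.isDecaying j hσ) h.outer_lt_pi.le h.lt_angle h.lt_outer
  have hmain := contour_hasDerivAt (C := C * D) h.angle_nonneg hA.neg_one_lt hA.lt_zero
    (F := fun σ z => powExp α k σ z • resolvent A z)
    (F' := fun σ z => -powExp α (k + 1) σ z • resolvent A z) hs
    (fun σ hσ => hint k σ (hκ0.trans hσ)) ?_ ?_ ?_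
  · have h1 : (contour θ fun z => -powExp α (k + 1) τ z • resolvent A z) =
        -powSemigroup A α θ (k + 1) τ := by
      rw [powSemigroup, funCalc_eq_contour, ← neg_one_smul ℂ (contour θ _), ← contour_smul]
      simp only [neg_smul, one_smul]
    rw [h1] at hmain
    refine hmain.congr_of_eventuallyEq (Eventually.of_forall fun σ => ?_)
    exact funCalc_eq_contour A θ _
  · intro a ha
    have := (hint (k + 1) τ hτ a ha).neg
    simp only [RayIntegrable, neg_smul]
    exact this
  · intro σ hσ a ha ρ hρ
    have hσ : κ < decayRate (Real.cos (α * μ)) σ := hσ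
    have h1 := hb σ hσ.le _ (polar_mem_openSector h.outer_lt_pi.le hρ (ha.trans_lt h.lt_outer))
    have h2 := hR ρ a hρ ha.ge (by linarith [h.lt_outer, h.outer_lt_pi])
    rw [norm_polar hρ.le] at h1
    rw [norm_smul, norm_neg]
    calc _ ≤ C / (1 + ρ) * (D * ρ ^ γ) := by gcongr
      _ = _ := by rw [weight]; ring
  · intro σ hσ z
    exact (hasDerivAt_powExp k σ z).smul_const (resolvent A z)

theorem hasDerivAt_powSemigroup_real (h : Admissible A γ ω α θ μ) (k : ℕ) {t : ℝ} (ht : 0 < t) :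
    HasDerivAt (fun t : ℝ => powSemigroup A α θ k t) (-powSemigroup A α θ (k + 1) t) t := by
  have := (h.hasDerivAt_powSemigroup k (h.decayRate_pos ht)).scomp t
    (Complex.ofRealCLM.hasDerivAt (x := t))
  rwa [Complex.ofRealCLM_apply, Complex.ofReal_one, one_smul] at this

theorem commute_powSemigroup (h : Admissible A γ ω α θ μ) {f : ℂ → ℂ} (hf : IsDecaying μ f)
    (k : ℕ) {t : ℝ} (ht : 0 < t) : Commute (funCalc A θ f) (powSemigroup A α θ k t) := by
  have h1 := h.isDecaying k (h.decayRate_pos ht)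
  have hA := h.isAlmostSectorial
  rw [Commute, SemiconjBy, powSemigroup,
    hA.funCalc_mul_funCalc hf h1 h.outer_lt_pi.le h.lt_angle h.lt_outer,
    hA.funCalc_mul_funCalc h1 hf h.outer_lt_pi.le h.lt_angle h.lt_outer]
  simp only [mul_comm]

theorem commute_invOneAdd_powSemigroup (h : Admissible A γ ω α θ μ) (k : ℕ) {t : ℝ}
    (ht : 0 < t) : Commute (invOneAdd A) (powSemigroup A α θ k t) := by
  rw [← h.isAlmostSectorial.funCalc_one_add_inv h.lt_angle (h.lt_outer.trans h.outer_lt_pi)]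
  exact h.commute_powSemigroup (isDecaying_one_add_inv h.outer_nonneg h.outer_lt_pi) k ht

/-- Although the semigroup need not be strongly continuous at `0`, it is so after `(1 + A)⁻¹`. -/
theorem tendsto_invOneAdd_mul (h : Admissible A γ ω α θ μ) :
    Tendsto (fun t : ℝ => invOneAdd A * powSemigroup A α θ 0 t) (𝓝[>] 0) (𝓝 (invOneAdd A)) := by
  have hA := h.isAlmostSectorial
  have hone := isDecaying_one_add_inv h.outer_nonneg h.outer_lt_pi
  have hθπ := h.lt_outer.trans h.outer_lt_pi
  obtain ⟨C, hC, hb⟩ := hA.exists_bound_smul hone h.outer_lt_pi.le h.lt_angle h.lt_outer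
  have hlim := contour_tendsto (l := 𝓝[>] (0 : ℝ)) (C := C) h.angle_nonneg hA.neg_one_lt hA.lt_zero
    (F := fun t z => ((1 + z)⁻¹ * powExp α 0 (t : ℝ) z) • resolvent A z)
    (G := fun z => (1 + z)⁻¹ • resolvent A z) ?_ ?_ ?_
  · rw [← funCalc_eq_contour, hA.funCalc_one_add_inv h.lt_angle hθπ] at hlim
    refine hlim.congr' ?_
    filter_upwards [self_mem_nhdsWithin] with t ht
    have h1 := h.isDecaying 0 (h.decayRate_pos ht)
    rw [← funCalc_eq_contour,
      ← hA.funCalc_mul_funCalc hone h1 h.outer_lt_pi.le h.lt_angle h.lt_outer,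
      hA.funCalc_one_add_inv h.lt_angle hθπ, powSemigroup]
  · filter_upwards [self_mem_nhdsWithin] with t ht
    exact hA.contourIntegrable (hone.mul (h.isDecaying 0 (h.decayRate_pos ht)))
      h.outer_lt_pi.le h.lt_angle h.lt_outer
  · filter_upwards [self_mem_nhdsWithin] with t ht a ha ρ hρ
    have ht : 0 < t := ht
    have hmem := polar_mem_openSector h.outer_lt_pi.le hρ (ha.trans_lt h.lt_outer)
    -- The exponential is bounded by `1` uniformly in `t > 0`, so `(1 + z)⁻¹ R(z)` alone supplies
    -- the integrable majorant; without the regularizer there would be none of this form.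
    have h1 : ‖powExp α 0 t (polar ρ a)‖ ≤ 1 := by
      refine (norm_powExp_le h.pos h.outer_lt_pi.le h.outer_mul_lt
        (by simpa using ht.le) hmem).trans ?_
      rw [pow_zero, one_mul, Real.exp_le_one_iff, neg_nonpos]
      have := h.decayRate_pos ht
      positivity
    rw [mul_comm, mul_smul, norm_smul]
    exact (mul_le_of_le_one_left (norm_nonneg _) h1).trans
      (hb ρ a hρ ha.ge (ha.trans_lt h.lt_outer)).2
  · intro z
    have hc : Continuous fun t : ℝ =>
        ((1 + z)⁻¹ * powExp α 0 (t : ℝ) z) • resolvent A z := by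
      unfold powExp; fun_prop
    have := (hc.tendsto 0).mono_left (nhdsWithin_le_nhds (s := Ioi 0))
    simpa [powExp] using this

theorem powSemigroup_mul (h : Admissible A γ ω α θ μ) {s t : ℝ} (hs : 0 < s) (ht : 0 < t) :
    powSemigroup A α θ 0 s * powSemigroup A α θ 0 t = powSemigroup A α θ 0 (s + t : ℝ) := by
  rw [powSemigroup, powSemigroup, h.isAlmostSectorial.funCalc_mul_funCalc
    (h.isDecaying 0 (h.decayRate_pos hs)) (h.isDecaying 0 (h.decayRate_pos ht))
    h.outer_lt_pi.le h.lt_angle h.lt_outer, powSemigroup]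
  congr 1
  ext z
  simp only [powExp, pow_zero, one_mul, ← Complex.exp_add]
  congr 1; push_cast; ring

/-- The operators `e^{-t A^α}` are injective. -/
theorem powSemigroup_injective (h : Admissible A γ ω α θ μ) {t : ℝ} (ht : 0 < t) :
    Function.Injective (powSemigroup A α θ 0 t) := by
  refine (injective_iff_map_eq_zero _).2 fun x hx => ?_
  set U : Set ℂ := {τ | 0 < decayRate (Real.cos (α * μ)) τ} with hU
  have hUo : IsOpen U := isOpen_lt continuous_const (continuous_decayRate _)
  have hd : DifferentiableOn ℂ (fun τ => powSemigroup A α θ 0 τ x) U := fun τ hτ =>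
    ((h.hasDerivAt_powSemigroup 0 hτ).differentiableAt.clm_apply
      (differentiableAt_const x)).differentiableWithinAt
  have hzero : ∀ s : ℝ, t < s → powSemigroup A α θ 0 s x = 0 := by
    intro s hs
    have h1 := h.powSemigroup_mul (sub_pos.2 hs) ht
    rw [sub_add_cancel] at h1
    rw [← h1]
    change powSemigroup A α θ 0 (s - t : ℝ) (powSemigroup A α θ 0 t x) = 0
    rw [hx, map_zero]
  have ht1 : ((t + 1 : ℝ) : ℂ) ∈ U := h.decayRate_pos (by linarith)
  have hfreq : ∃ᶠ τ in 𝓝[≠] ((t + 1 : ℝ) : ℂ), powSemigroup A α θ 0 τ x = 0 := by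
    have htend : Tendsto (fun s : ℝ => (s : ℂ)) (𝓝[>] (t + 1)) (𝓝[≠] ((t + 1 : ℝ) : ℂ)) := by
      refine tendsto_nhdsWithin_iff.2 ⟨?_, ?_⟩
      · exact (Complex.continuous_ofReal.tendsto _).mono_left nhdsWithin_le_nhds
      · filter_upwards [self_mem_nhdsWithin] with s hs
        have hs : t + 1 < s := hs
        exact fun h => hs.ne' (Complex.ofReal_injective h)
    refine htend.frequently (Eventually.frequently ?_)
    filter_upwards [self_mem_nhdsWithin] with s hs
    have hs : t + 1 < s := hs
    exact hzero s (by linarith)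
  -- By the semigroup law the orbit vanishes at all times beyond `t`. The identity theorem carries
  -- this to the whole convex sector of complex times, hence to times tending to `0`, where the
  -- regularized orbit tends to `(1 + A)⁻¹ x`.
  have hall := (hd.analyticOnNhd hUo).eqOn_zero_of_preconnected_of_frequently_eq_zero
    (convex_decayRate_pos _).isPreconnected ht1 hfreq
  have hlim : Tendsto (fun s : ℝ => (invOneAdd A * powSemigroup A α θ 0 s) x) (𝓝[>] 0)
      (𝓝 (invOneAdd A x)) :=
    ((ContinuousLinearMap.apply ℂ X x).continuous.tendsto _).comp h.tendsto_invOneAdd_mul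
  have hconst : Tendsto (fun s : ℝ => (invOneAdd A * powSemigroup A α θ 0 s) x) (𝓝[>] 0)
      (𝓝 0) := by
    refine tendsto_const_nhds.congr' ?_
    filter_upwards [self_mem_nhdsWithin] with s hs
    have h1 : powSemigroup A α θ 0 s x = 0 := hall (h.decayRate_pos hs)
    change 0 = invOneAdd A (powSemigroup A α θ 0 s x)
    rw [h1, map_zero]
  have := tendsto_nhds_unique hlim hconst
  exact h.isAlmostSectorial.invOneAdd_injective (this.trans (map_zero _).symm)

/-- By multiplicativity both sides are the calculus applied to `(1 + z)^{-m} (z^α)^{k+1} e^{-t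
z^α}`. -/
theorem regPow_mul_powSemigroup (h : Admissible A γ ω α θ μ) (k : ℕ) {t : ℝ} (ht : 0 < t) :
    funCalc A θ (regPow α) * powSemigroup A α θ k t =
      invOneAdd A ^ regExponent α * powSemigroup A α θ (k + 1) t := by
  have hA := h.isAlmostSectorial
  have hd := h.decayRate_pos ht
  rw [powSemigroup, hA.funCalc_mul_funCalc
    (isDecaying_regPow h.pos h.outer_nonneg h.outer_lt_pi) (h.isDecaying k hd)
    h.outer_lt_pi.le h.lt_angle h.lt_outer, powSemigroup,
    ← (hA.invOneAdd_pow_mul_funCalc (h.isDecaying (k + 1) hd) h.outer_lt_pi h.lt_angle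
      h.lt_outer (regExponent α)).2]
  congr 1
  ext z
  simp only [regPow, powExp, pow_succ, inv_pow]
  ring

/-- `A^α e^{-tA^α} = (z^α e^{-t z^α})(A)`. -/
theorem fracPow_powSemigroup (h : Admissible A γ ω α θ μ) {t : ℝ} (ht : 0 < t) (x : X) :
    ∃ hx : powSemigroup A α θ 0 t x ∈ (fracPow A α θ).domain,
      fracPow A α θ ⟨powSemigroup A α θ 0 t x, hx⟩ = powSemigroup A α θ 1 t x :=
  h.mem_fracPow_iff.2
    (congrArg (fun L : X →L[ℂ] X => L x) (h.regPow_mul_powSemigroup 0 ht))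

/-- `e^{-tA^α} A^α ⊆ (z^α e^{-t z^α})(A)`. -/
theorem powSemigroup_fracPow (h : Admissible A γ ω α θ μ) {t : ℝ} (ht : 0 < t)
    (x : (fracPow A α θ).domain) :
    powSemigroup A α θ 0 t (fracPow A α θ x) = powSemigroup A α θ 1 t x := by
  have hx := h.mem_fracPow_iff.1 ⟨x.2, rfl⟩
  refine h.isAlmostSectorial.invOneAdd_pow_injective (regExponent α) ?_
  have h1 := ((h.commute_invOneAdd_powSemigroup 0 ht).pow_left (regExponent α)).eq
  have h2 := (h.commute_powSemigroup
    (isDecaying_regPow h.pos h.outer_nonneg h.outer_lt_pi) 0 ht).eq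
  have h3 := h.regPow_mul_powSemigroup 0 ht
  have h1' := congrArg (fun L : X →L[ℂ] X => L (fracPow A α θ x)) h1
  have h2' := congrArg (fun L : X →L[ℂ] X => L x) (h2.symm.trans h3)
  exact h1'.trans ((congrArg (powSemigroup A α θ 0 t) hx.symm).trans h2')

end Admissible

end Semigroup

/-! ### The primitive of a coefficient -/

section Primitive

variable {φ : ℝ → ℝ}

theorem IsCoefficient.intervalIntegrable (hφ : IsCoefficient φ) {s t : ℝ} (hs : 0 ≤ s)
    (ht : 0 ≤ t) : IntervalIntegrable φ volume s t :=
  (hφ.continuousOn.mono fun _ hr => (le_inf hs ht).trans hr.1).intervalIntegrable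

theorem IsCoefficient.continuousAt (hφ : IsCoefficient φ) {t : ℝ} (ht : 0 < t) :
    ContinuousAt φ t :=
  hφ.continuousOn.continuousAt (Ici_mem_nhds ht)

theorem IsCoefficient.hasDerivAt_integral (hφ : IsCoefficient φ) {t : ℝ} (ht : 0 < t) :
    HasDerivAt (fun t => ∫ r in (0 : ℝ)..t, φ r) (φ t) t :=
  intervalIntegral.integral_hasDerivAt_right (hφ.intervalIntegrable le_rfl ht.le)
    ((hφ.continuousOn.mono Ioi_subset_Ici_self).stronglyMeasurableAtFilter isOpen_Ioi t ht)
    (hφ.continuousAt ht)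

theorem IsCoefficient.integral_lt (hφ : IsCoefficient φ) {s t : ℝ} (hs : 0 ≤ s) (hst : s < t) :
    ∫ r in (0 : ℝ)..s, φ r < ∫ r in (0 : ℝ)..t, φ r := by
  have h0 : 0 ≤ t := hs.trans hst.le
  rw [← sub_pos, intervalIntegral.integral_interval_sub_left
    (hφ.intervalIntegrable le_rfl h0) (hφ.intervalIntegrable le_rfl hs)]
  exact intervalIntegral.intervalIntegral_pos_of_pos_on (hφ.intervalIntegrable hs h0)
    (fun r hr => hφ.pos r (hs.trans_lt hr.1)) hst

theorem IsCoefficient.integral_pos (hφ : IsCoefficient φ) {t : ℝ} (ht : 0 < t) :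
    0 < ∫ r in (0 : ℝ)..t, φ r := by
  simpa using hφ.integral_lt le_rfl ht

theorem IsCoefficient.tendsto_integral (hφ : IsCoefficient φ) :
    Tendsto (fun t => ∫ r in (0 : ℝ)..t, φ r) (𝓝[>] 0) (𝓝[>] 0) := by
  refine tendsto_nhdsWithin_iff.2 ⟨?_, ?_⟩
  · have h1 : ContinuousOn (fun t => ∫ r in (0 : ℝ)..t, φ r) (Icc 0 1) := by
      have := intervalIntegral.continuousOn_primitive_interval (a := 0) (b := 1) (μ := volume)
        (f := φ) ?_
      · rwa [uIcc_of_le zero_le_one] at this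
      · exact (hφ.continuousOn.mono fun r hr => by
          rw [uIcc_of_le zero_le_one] at hr; exact hr.1).integrableOn_compact isCompact_uIcc
    have h2 := (h1 0 ⟨le_rfl, zero_le_one⟩).tendsto
    rw [intervalIntegral.integral_same] at h2
    refine h2.mono_left ?_
    rw [← nhdsWithin_Ioo_eq_nhdsGT (zero_lt_one' ℝ)]
    exact nhdsWithin_mono _ Ioo_subset_Icc_self
  · filter_upwards [self_mem_nhdsWithin] with t ht
    exact hφ.integral_pos ht

end Primitive

/-! ### Uniqueness, existence and the inverse problem -/

section Cauchy

variable {X : Type*} [NormedAddCommGroup X] [NormedSpace ℂ X]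

theorem hasDerivAt_clm_apply {S : ℝ → X →L[ℂ] X} {S' : X →L[ℂ] X} {u : ℝ → X} {u' : X} {t : ℝ}
    (hS : HasDerivAt S S' t) (hu : HasDerivAt u u' t) :
    HasDerivAt (fun s => S s (u s)) (S' (u t) + S t u') t := by
  have h1 : HasDerivAt (fun s => (S s).restrictScalars ℝ) (S'.restrictScalars ℝ) t :=
    (ContinuousLinearMap.restrictScalarsL ℂ X X ℝ ℝ).hasFDerivAt.comp_hasDerivAt t hS
  exact h1.clm_apply hu

theorem tendsto_clm_apply {ι : Type*} {l : Filter ι} {S : ι → X →L[ℂ] X} {L : X →L[ℂ] X}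
    {u : ι → X} {x : X} (hS : Tendsto S l (𝓝 L)) (hu : Tendsto u l (𝓝 x)) :
    Tendsto (fun i => S i (u i)) l (𝓝 (L x)) :=
  (isBoundedBilinearMap_apply (𝕜 := ℂ) (E := X) (F := X)).continuous.tendsto (L, x) |>.comp
    (hS.prodMk_nhds hu)

variable {A : X →ₗ.[ℂ] X} {γ ω α θ μ : ℝ} [CompleteSpace X]

namespace Admissible

/-- If `u' = ψ' A^α u`, then `e^{-ψ A^α} u` is constant. -/
theorem powSemigroup_apply_eq (h : Admissible A γ ω α θ μ) {a b : ℝ} {ψ c : ℝ → ℝ} {u : ℝ → X}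
    (hψ : ∀ s ∈ Ioo a b, HasDerivAt ψ (c s) s) (hpos : ∀ s ∈ Ioo a b, 0 < ψ s)
    (hu : ∀ s ∈ Ioo a b, ∃ hx : u s ∈ (fracPow A α θ).domain,
      HasDerivAt u (c s • fracPow A α θ ⟨u s, hx⟩) s) {s s' : ℝ} (hs : s ∈ Ioo a b)
    (hs' : s' ∈ Ioo a b) :
    powSemigroup A α θ 0 (ψ s) (u s) = powSemigroup A α θ 0 (ψ s') (u s') := by
  have hd : ∀ r ∈ Ioo a b,
      HasDerivAt (fun r => powSemigroup A α θ 0 (ψ r) (u r)) 0 r := by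
    intro r hr
    obtain ⟨hx, hur⟩ := hu r hr
    -- The product rule gives `-c (z^α e^{-ψ z^α})(A) u + c e^{-ψ A^α} A^α u`, and the two terms
    -- cancel because `e^{-ψ A^α} A^α u = (z^α e^{-ψ z^α})(A) u`.
    have h1 := (h.hasDerivAt_powSemigroup_real 0 (hpos r hr)).scomp r (hψ r hr)
    have h2 := hasDerivAt_clm_apply h1 hur
    refine h2.congr_deriv ?_
    have h3 := h.powSemigroup_fracPow (hpos r hr) ⟨u r, hx⟩
    have h4 : powSemigroup A α θ 0 (ψ r) (c r • fracPow A α θ ⟨u r, hx⟩) =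
        c r • powSemigroup A α θ 0 (ψ r) (fracPow A α θ ⟨u r, hx⟩) :=
      ((powSemigroup A α θ 0 (ψ r)).restrictScalars ℝ).map_smul _ _
    simp only [Function.comp_apply]
    rw [h4, h3]
    change c r • (-(powSemigroup A α θ (0 + 1) (ψ r) (u r))) + _ = 0
    rw [smul_neg, zero_add, neg_add_cancel]
  exact isOpen_Ioo.is_const_of_deriv_eq_zero isPreconnected_Ioo
    (fun r hr => (hd r hr).differentiableAt.differentiableWithinAt)
    (fun r hr => (hd r hr).deriv) hs hs'

theorem tendsto_invOneAdd_apply (h : Admissible A γ ω α θ μ) {ι : Type*} {l : Filter ι}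
    {ψ : ι → ℝ} {u : ι → X} {x : X} (hψ : Tendsto ψ l (𝓝[>] 0)) (hu : Tendsto u l (𝓝 x)) :
    Tendsto (fun i => invOneAdd A (powSemigroup A α θ 0 (ψ i) (u i))) l
      (𝓝 (invOneAdd A x)) :=
  tendsto_clm_apply (S := fun i => invOneAdd A * powSemigroup A α θ 0 (ψ i))
    (h.tendsto_invOneAdd_mul.comp hψ) hu

theorem tendsto_powSemigroup (h : Admissible A γ ω α θ μ) (k : ℕ) {ι : Type*} {l : Filter ι}
    {ψ : ι → ℝ} {t : ℝ} (ht : 0 < t) (hψ : Tendsto ψ l (𝓝 t)) :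
    Tendsto (fun i => powSemigroup A α θ k (ψ i)) l (𝓝 (powSemigroup A α θ k t)) :=
  (h.hasDerivAt_powSemigroup_real k ht).continuousAt.tendsto.comp hψ

theorem powSemigroup_invOneAdd_apply (h : Admissible A γ ω α θ μ) {t : ℝ} (ht : 0 < t) (x : X) :
    powSemigroup A α θ 0 t (invOneAdd A x) = invOneAdd A (powSemigroup A α θ 0 t x) :=
  congrArg (fun L : X →L[ℂ] X => L x) (h.commute_invOneAdd_powSemigroup 0 ht).eq.symm

variable {φ : ℝ → ℝ} {T : ℝ} {x₀ : X} {u : ℝ → X}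

/-- Solutions of the forward equation are given by the semigroup. -/
theorem eq_powSemigroup_apply (h : Admissible A γ ω α θ μ) (hφ : IsCoefficient φ)
    (hu : IsClassicalSolution A α θ T (fun t => (-1) * φ t) x₀ u) {t : ℝ} (ht : t ∈ Ioo 0 T) :
    u t = powSemigroup A α θ 0 (∫ r in (0 : ℝ)..t, φ r : ℝ) x₀ := by
  have hA := h.isAlmostSectorial
  set Φ : ℝ → ℝ := fun t => ∫ r in (0 : ℝ)..t, φ r with hΦ
  change u t = powSemigroup A α θ 0 (Φ t) x₀
  have hΦt : 0 < Φ t := hφ.integral_pos ht.1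
  have hmid : t / 2 ∈ Ioo 0 t := ⟨by linarith [ht.1], by linarith [ht.1]⟩
  set y := powSemigroup A α θ 0 (Φ t - Φ (t / 2) : ℝ) (u (t / 2)) with hy
  have hconst : ∀ s ∈ Ioo 0 t, powSemigroup A α θ 0 (Φ t - Φ s : ℝ) (u s) = y := by
    intro s hs
    refine h.powSemigroup_apply_eq (ψ := fun s => Φ t - Φ s) (c := fun s => (-1) * φ s)
      (fun r hr => ?_) (fun r hr => sub_pos.2 (hφ.integral_lt hr.1.le hr.2))
      (fun r hr => hu.equation r ⟨hr.1, hr.2.trans ht.2⟩) hs hmid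
    simpa using (hφ.hasDerivAt_integral hr.1).const_sub (Φ t)
  -- The limit `s → t⁻` sends the time argument to `0`, where only the regularized semigroup
  -- converges; injectivity of `(1 + A)⁻¹` removes the regularizer.
  have hut : u t = y := by
    refine hA.invOneAdd_injective ?_
    have hcont : Tendsto u (𝓝[<] t) (𝓝 (u t)) :=
      (hu.equation t ht).choose_spec.continuousAt.tendsto.mono_left nhdsWithin_le_nhds
    have hψ : Tendsto (fun s => Φ t - Φ s) (𝓝[<] t) (𝓝[>] 0) := by
      refine tendsto_nhdsWithin_iff.2 ⟨?_, ?_⟩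
      · have := ((hφ.hasDerivAt_integral ht.1).continuousAt.tendsto.const_sub (Φ t)).mono_left
          (nhdsWithin_le_nhds (s := Iio t))
        rwa [sub_self] at this
      · filter_upwards [Ioo_mem_nhdsLT ht.1] with s hs
        exact sub_pos.2 (hφ.integral_lt hs.1.le hs.2)
    refine tendsto_nhds_unique (h.tendsto_invOneAdd_apply hψ hcont) ?_
    refine tendsto_const_nhds.congr' ?_
    filter_upwards [Ioo_mem_nhdsLT ht.1] with s hs
    rw [hconst s hs]
  rw [hut]
  refine hA.invOneAdd_injective ?_
  have hatt := hA.tendsto_resolvent_zero_iff.1 hu.attained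
  have hψ : Tendsto (fun s => Φ t - Φ s) (𝓝[>] 0) (𝓝 (Φ t)) := by
    have := (tendsto_nhdsWithin_iff.1 hφ.tendsto_integral).1.const_sub (Φ t)
    rwa [sub_zero] at this
  -- As `s → 0⁺` the time argument tends to `Φ t > 0`, where the semigroup is norm continuous, so
  -- the weak form of the initial condition suffices.
  have hlim := tendsto_clm_apply (h.tendsto_powSemigroup 0 hΦt hψ) hatt
  rw [h.powSemigroup_invOneAdd_apply hΦt] at hlim
  refine tendsto_nhds_unique (tendsto_const_nhds.congr' ?_) hlim
  filter_upwards [Ioo_mem_nhdsGT ht.1] with s hs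
  rw [h.powSemigroup_invOneAdd_apply (sub_pos.2 (hφ.integral_lt hs.1.le hs.2)), hconst s hs]

/-- The semigroup recovers the initial value from a solution of the backward equation. -/
theorem powSemigroup_apply_eq_initial (h : Admissible A γ ω α θ μ) (hφ : IsCoefficient φ)
    (hu : IsClassicalSolution A α θ T (fun t => 1 * φ t) x₀ u) {t : ℝ} (ht : t ∈ Ioo 0 T) :
    powSemigroup A α θ 0 (∫ r in (0 : ℝ)..t, φ r : ℝ) (u t) = x₀ := by
  have hA := h.isAlmostSectorial
  set Φ : ℝ → ℝ := fun t => ∫ r in (0 : ℝ)..t, φ r with hΦ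
  change powSemigroup A α θ 0 (Φ t) (u t) = x₀
  have hΦt : 0 < Φ t := hφ.integral_pos ht.1
  -- For fixed `r`, the function `s ↦ e^{-(Φ s - Φ r) A^α} u(s)` is constant on `(r, T)`; its
  -- regularized limit as `s → r⁺` identifies the constant as `u r`.
  have hback : ∀ r ∈ Ioo 0 t, powSemigroup A α θ 0 (Φ t - Φ r : ℝ) (u t) = u r := by
    intro r hr
    have hrT : r < T := hr.2.trans ht.2
    refine hA.invOneAdd_injective ?_
    have hcont : Tendsto u (𝓝[>] r) (𝓝 (u r)) :=
      (hu.equation r ⟨hr.1, hrT⟩).choose_spec.continuousAt.tendsto.mono_left nhdsWithin_le_nhds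
    have hψ : Tendsto (fun s => Φ s - Φ r) (𝓝[>] r) (𝓝[>] 0) := by
      refine tendsto_nhdsWithin_iff.2 ⟨?_, ?_⟩
      · have := ((hφ.hasDerivAt_integral hr.1).continuousAt.tendsto.sub_const (Φ r)).mono_left
          (nhdsWithin_le_nhds (s := Ioi r))
        rwa [sub_self] at this
      · filter_upwards [self_mem_nhdsWithin] with s hs
        exact sub_pos.2 (hφ.integral_lt hr.1.le hs)
    refine tendsto_nhds_unique ?_ (h.tendsto_invOneAdd_apply hψ hcont)
    refine tendsto_const_nhds.congr' ?_
    filter_upwards [Ioo_mem_nhdsGT hrT] with s hs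
    refine congrArg _ (h.powSemigroup_apply_eq (ψ := fun s => Φ s - Φ r) (c := fun s => 1 * φ s)
      (fun p hp => ?_) (fun p hp => sub_pos.2 (hφ.integral_lt hr.1.le hp.1))
      (fun p hp => hu.equation p ⟨hr.1.trans hp.1, hp.2⟩) ⟨hr.2, ht.2⟩ hs)
    simpa using (hφ.hasDerivAt_integral (hr.1.trans hp.1)).sub_const (Φ r)
  refine hA.invOneAdd_injective ?_
  have hatt := hA.tendsto_resolvent_zero_iff.1 hu.attained
  have hψ : Tendsto (fun s => Φ t - Φ s) (𝓝[>] 0) (𝓝 (Φ t)) := by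
    have := (tendsto_nhdsWithin_iff.1 hφ.tendsto_integral).1.const_sub (Φ t)
    rwa [sub_zero] at this
  have hlim := tendsto_clm_apply (h.tendsto_powSemigroup 0 hΦt hψ)
    (tendsto_const_nhds (x := invOneAdd A (u t)))
  rw [h.powSemigroup_invOneAdd_apply hΦt] at hlim
  refine tendsto_nhds_unique hlim (hatt.congr' ?_)
  filter_upwards [Ioo_mem_nhdsGT ht.1] with s hs
  rw [h.powSemigroup_invOneAdd_apply (sub_pos.2 (hφ.integral_lt hs.1.le hs.2)), hback s hs]

theorem exists_isClassicalSolution (h : Admissible A γ ω α θ μ) (hφ : IsCoefficient φ) (T : ℝ)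
    (x₀ : X) : ∃ u : ℝ → X, IsClassicalSolution A α θ T (fun t => (-1) * φ t) x₀ u := by
  classical
  set Φ : ℝ → ℝ := fun t => ∫ r in (0 : ℝ)..t, φ r with hΦ
  -- The contour formula is meant for positive times, so the initial value is inserted by hand.
  set u : ℝ → X := fun t => if t = 0 then x₀ else powSemigroup A α θ 0 (Φ t) x₀ with hu
  have hut : ∀ t, 0 < t → u t = powSemigroup A α θ 0 (Φ t) x₀ := fun t ht => if_neg ht.ne'
  have hder : ∀ t, 0 < t →
      HasDerivAt u (((-1) * φ t) • powSemigroup A α θ 1 (Φ t) x₀) t := by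
    intro t ht
    have h1 := (h.hasDerivAt_powSemigroup_real 0 (hφ.integral_pos ht)).scomp t
      (hφ.hasDerivAt_integral ht)
    have h2 := hasDerivAt_clm_apply h1 (hasDerivAt_const t x₀)
    have h3 : u =ᶠ[𝓝 t] fun t => powSemigroup A α θ 0 (Φ t) x₀ := by
      filter_upwards [Ioi_mem_nhds ht] with s hs
      exact hut s hs
    refine (h2.congr_of_eventuallyEq h3).congr_deriv ?_
    rw [map_zero, add_zero, neg_one_mul, neg_smul, ← smul_neg]
    rfl
  refine ⟨u, ?_, ?_, if_pos rfl, ?_⟩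
  · rw [← zero_add (1 : WithTop ℕ∞), contDiffOn_succ_iff_deriv_of_isOpen isOpen_Ioo]
    refine ⟨fun t ht => (hder t ht.1).differentiableAt.differentiableWithinAt, by simp, ?_⟩
    rw [contDiffOn_zero]
    refine ContinuousOn.congr (f := fun t => ((-1) * φ t) • powSemigroup A α θ 1 (Φ t) x₀)
      (fun t ht => ContinuousAt.continuousWithinAt ?_) (fun t ht => (hder t ht.1).deriv)
    refine ((hφ.continuousAt ht.1).const_mul (-1)).smul ?_
    exact tendsto_clm_apply (h.tendsto_powSemigroup 1 (hφ.integral_pos ht.1)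
      (hφ.hasDerivAt_integral ht.1).continuousAt.tendsto) tendsto_const_nhds
  · intro t ht
    obtain ⟨hx, hy⟩ := h.fracPow_powSemigroup (hφ.integral_pos ht.1) x₀
    have h1 : ∃ hx : u t ∈ (fracPow A α θ).domain,
        fracPow A α θ ⟨u t, hx⟩ = powSemigroup A α θ 1 (Φ t) x₀ := by
      rw [hut t ht.1]; exact ⟨hx, hy⟩
    obtain ⟨hx', hy'⟩ := h1
    exact ⟨hx', by rw [hy']; exact hder t ht.1⟩
  · refine h.isAlmostSectorial.tendsto_resolvent_zero_iff.2 ?_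
    refine (h.tendsto_invOneAdd_apply hφ.tendsto_integral
      (tendsto_const_nhds (x := x₀))).congr' ?_
    filter_upwards [self_mem_nhdsWithin] with t ht
    rw [hut t ht]

/-- If `u` and `v` solve the same equation with initial values `u₀` and `A^α u₀`, then
`v = A^α u`. -/
theorem fracPow_solution (h : Admissible A γ ω α θ μ) (hφ : IsCoefficient φ) {σ : ℝ}
    (hσ : σ = 1 ∨ σ = -1) {u₀ : (fracPow A α θ).domain} {v : ℝ → X}
    (hu : IsClassicalSolution A α θ T (fun t => σ * φ t) (u₀ : X) u)
    (hv : IsClassicalSolution A α θ T (fun t => σ * φ t) (fracPow A α θ u₀) v)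
    {t : ℝ} (ht : t ∈ Ioo 0 T) : HasDerivAt u ((σ * φ t) • v t) t := by
  have hpos := hφ.integral_pos ht.1
  obtain ⟨hx, hd⟩ := hu.equation t ht
  suffices hs : fracPow A α θ ⟨u t, hx⟩ = v t by rwa [hs] at hd
  rcases hσ with rfl | rfl
  · have h1 := h.powSemigroup_apply_eq_initial hφ hu ht
    have h2 := h.powSemigroup_apply_eq_initial hφ hv ht
    -- With `S = e^{-Φ(t) A^α}`: `S A^α u(t) = A^α S u(t) = A^α u₀ = S v(t)`, so cancelling `S`
    -- gives `A^α u(t) = v(t)`.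
    refine h.powSemigroup_injective hpos ?_
    obtain ⟨hx', hy'⟩ := h.fracPow_powSemigroup hpos (u t)
    have h3 : u₀ = ⟨_, hx'⟩ := Subtype.ext h1.symm
    rw [h.powSemigroup_fracPow hpos, h2, h3, hy']
  · have h1 := h.eq_powSemigroup_apply hφ hu ht
    have h2 := h.eq_powSemigroup_apply hφ hv ht
    obtain ⟨hx', hy'⟩ := h.fracPow_powSemigroup hpos (u₀ : X)
    have h3 : (⟨u t, hx⟩ : (fracPow A α θ).domain) = ⟨_, hx'⟩ := Subtype.ext h1
    rw [h3, hy', h2, h.powSemigroup_fracPow hpos]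

/-- The coefficient is determined by the data. -/
theorem coefficient_eq (h : Admissible A γ ω α θ μ) {σ : ℝ} (hσ : σ = 1 ∨ σ = -1)
    {u₀ : (fracPow A α θ).domain} {q : X →L[ℂ] ℂ} {h₁ h₂ : ℝ → ℂ}
    (hφ : SolvesInverseProblem A α θ T σ u₀ q h₁ h₂ φ) {t : ℝ} (ht : t ∈ Ioo 0 T)
    (h0 : h₂ t ≠ 0) :
    DifferentiableAt ℝ h₁ t ∧ (φ t : ℂ) = (σ : ℂ) * (deriv h₁ t / h₂ t) := by
  obtain ⟨hφc, u, v, hu, hv, hobs⟩ := hφ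
  have h1 := (q.restrictScalars ℝ).hasFDerivAt.comp_hasDerivAt t
    (h.fracPow_solution hφc hσ hu hv ht)
  have h2 : h₁ =ᶠ[𝓝 t] (q.restrictScalars ℝ) ∘ u := by
    filter_upwards [isOpen_Ioo.mem_nhds ht] with s hs
    exact (hobs s hs).1
  have h3 := h1.congr_of_eventuallyEq h2
  refine ⟨h3.differentiableAt, ?_⟩
  -- Here `h₁' = σ φ h₂`, and multiplying `h₁'/h₂` by `σ` recovers `φ` because `σ² = 1`.
  rw [h3.deriv, map_smul, ContinuousLinearMap.coe_restrictScalars', ← (hobs t ht).2,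
    Complex.real_smul, mul_div_cancel_right₀ _ h0, ← Complex.ofReal_mul, ← mul_assoc]
  rcases hσ with rfl | rfl <;> simp

end Admissible

/-- The data say nothing at `t = 0`; right continuity of the coefficients settles that point. -/
theorem IsCoefficient.eqOn_Ico {φ ψ : ℝ → ℝ} {T : ℝ} (hT : 0 < T) (hφ : IsCoefficient φ)
    (hψ : IsCoefficient ψ) (h : EqOn φ ψ (Ioo 0 T)) : EqOn φ ψ (Ico 0 T) := by
  intro t ht
  rcases ht.1.eq_or_lt with rfl | h0
  · have hlim : ∀ {χ : ℝ → ℝ}, IsCoefficient χ → Tendsto χ (𝓝[>] 0) (𝓝 (χ 0)) := fun hχ =>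
      ((hχ.continuousOn 0 self_mem_Ici).tendsto).mono_left (nhdsWithin_mono _ Ioi_subset_Ici_self)
    refine tendsto_nhds_unique (hlim hφ) ((hlim hψ).congr' ?_)
    filter_upwards [Ioo_mem_nhdsGT hT] with s hs
    exact (h hs).symm
  · exact h ⟨h0, ht.2⟩

end Cauchy

end AlmostSectorial

end

/-! ### Well-posedness and recovery of the coefficient -/

theorem mainTheorem2 {X : Type*} [NormedAddCommGroup X] [NormedSpace ℂ X] [CompleteSpace X]
    (γ ω : ℝ) (hω : 0 < ω) (hω' : ω < Real.pi / 2)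
    (A : X →ₗ.[ℂ] X) (hA : AlmostSectorial.IsAlmostSectorial γ ω A)
    (α : ℝ) (hα : 0 < α) (hα' : α < Real.pi / (2 * ω))
    (θ : ℝ) (hθ : ω < θ) (hθ' : θ < min Real.pi (Real.pi / (2 * α)))
    (T : ℝ) (hT : 0 < T) :
    (∀ φ : ℝ → ℝ, AlmostSectorial.IsCoefficient φ → ∀ x₀ : X,
      (∃ u : ℝ → X,
        AlmostSectorial.IsClassicalSolution A α θ T (fun t => (-1) * φ t) x₀ u) ∧
      ∀ u : ℝ → X, AlmostSectorial.IsClassicalSolution A α θ T (fun t => (-1) * φ t) x₀ u →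
        ∀ t ∈ Set.Ioo 0 T, u t = AlmostSectorial.semigroupOp A α θ (∫ r in (0 : ℝ)..t, φ r) x₀) ∧
    ∀ σ : ℝ, (σ = 1 ∨ σ = -1) →
      ∀ (u₀ : (AlmostSectorial.fracPow A α θ).domain) (q : X →L[ℂ] ℂ) (h₁ h₂ : ℝ → ℂ),
        (∃ φ : ℝ → ℝ, AlmostSectorial.SolvesInverseProblem A α θ T σ u₀ q h₁ h₂ φ) →
        (∀ t ∈ Set.Ioo 0 T, h₂ t ≠ 0) →
        ∃ φ : ℝ → ℝ, AlmostSectorial.SolvesInverseProblem A α θ T σ u₀ q h₁ h₂ φ ∧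
          (∀ t ∈ Set.Ioo 0 T, DifferentiableAt ℝ h₁ t ∧
            (φ t : ℂ) = (σ : ℂ) * (deriv h₁ t / h₂ t)) ∧
          ∀ ψ : ℝ → ℝ, AlmostSectorial.SolvesInverseProblem A α θ T σ u₀ q h₁ h₂ ψ →
            Set.EqOn ψ φ (Set.Ico 0 T) := by
  obtain ⟨μ, h⟩ := AlmostSectorial.exists_admissible hA hα hθ hθ'
  refine ⟨fun φ hφ x₀ => ⟨h.exists_isClassicalSolution hφ T x₀, fun u hu t ht => ?_⟩, ?_⟩
  · rw [AlmostSectorial.semigroupOp_eq]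
    exact h.eq_powSemigroup_apply hφ hu ht
  · rintro σ hσ u₀ q h₁ h₂ ⟨φ, hφ⟩ h0
    -- Every solution of the inverse problem obeys the same formula in terms of `h₁` and `h₂` alone,
    -- so the given solution is the only one.
    have hform := fun t ht => h.coefficient_eq hσ hφ ht (h0 t ht)
    refine ⟨φ, hφ, hform, fun ψ hψ => ?_⟩
    refine hψ.1.eqOn_Ico hT hφ.1 fun t ht => Complex.ofReal_injective ?_
    rw [(hform t ht).2, (h.coefficient_eq hσ hψ ht (h0 t ht)).2]
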